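/- All graphs are finite and simple. A graph is $k$-critical if its chromatic number is $k$ and deleting any edge makes it properly $(k-1)$-colorable; it is critical if it is $k$-critical for some $k$. The odd girth of a graph is the length of a shortest odd cycle ($\infty$ if there is none). For $\ell,k\in\mathbb N$ let the density constant $c_{\ell,k}$ be the supremum of the real numbers $c$ for which there is a family of infinitely many (pairwise non-isomorphic) $k$-critical graphs of odd girth $>\ell$, each having more than $cn^2$ edges, where $n$ is its number of vertices. Theorem. There is a dense family of critical graphs without triangles and pentagons which contains infinitely many $k$-chromatic graphs for every $k\ge 4$ (so its members have unbounded chromatic number). That is, there are a constant $c>0$ and a family $\mathcal F$ of critical graphs of odd girth $>5$ such that every $G\in\mathcal F$ on $n$ vertices has more than $cn^2$ edges, and such that for every $k\ge 4$ infinitely many members of $\mathcal F$ have chromatic number $k$. Moreover, $c_{5,4}\ge \frac1{36}$, $c_{5,5}\ge\frac3{35}$, and $c_{5,k}=\frac14$ for all $k\ge 6$. -/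

import Mathlib

/-- A finite graph: a number `n` of vertices together with a simple graph on `Fin n`.
Every finite simple graph is isomorphic to one of these, and only finitely many of them have
a given number of vertices, so a set of them is infinite exactly when it contains infinitely many
pairwise non-isomorphic graphs. -/
abbrev FinGraph : Type := Σ n : ℕ, SimpleGraph (Fin n)

/-- The number of vertices. -/
def FinGraph.order (G : FinGraph) : ℕ := G.1

/-- The number of edges. -/
noncomputable def FinGraph.size (G : FinGraph) : ℕ := G.2.edgeSet.ncard

/-- The length of a shortest odd cycle (`⊤` if there is no odd cycle). -/
noncomputable def SimpleGraph.oddGirth {V : Type*} (G : SimpleGraph V) : ℕ∞ :=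
  ⨅ (v : V) (w : G.Walk v v) (_ : w.IsCycle) (_ : Odd w.length), (w.length : ℕ∞)

/-- `G` is `k`-critical: it has chromatic number `k`, and removing any edge allows it to be
properly `(k - 1)`-colored. (If there is an edge then `2 ≤ k`, so the subtraction is the
usual one.) -/
def SimpleGraph.IsColorCritical {V : Type*} (G : SimpleGraph V) (k : ℕ) : Prop :=
  G.chromaticNumber = (k : ℕ∞) ∧ ∀ e ∈ G.edgeSet, (G.deleteEdges {e}).Colorable (k - 1)

/-- The real numbers `c` such that there is an infinite family of `k`-critical graphs of odd girth
`> ℓ`, each with more than `c * n ^ 2` edges, `n` being its number of vertices. -/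
def densitySet (ℓ k : ℕ) : Set ℝ :=
  {c | ∃ F : Set FinGraph, F.Infinite ∧ ∀ G ∈ F,
    G.2.IsColorCritical k ∧ (ℓ : ℕ∞) < G.2.oddGirth ∧ c * (G.order : ℝ) ^ 2 < (G.size : ℝ)}

/-- The density constant `c_{ℓ,k}`: the supremum of `densitySet ℓ k`. (The set is bounded above,
since a graph on `n` vertices has at most `n ^ 2 / 2` edges; a value other than `0` is only possible
if the set is nonempty and bounded above.) -/
noncomputable def densityConstant (ℓ k : ℕ) : ℝ := sSup (densitySet ℓ k)

/-!
The critical graphs are built by induction on the chromatic number, from *gadgets*. A gadget for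
`p` colors is a graph with an independent set `U` of terminals on which every `p`-coloring uses
more than `s` colors, in such a way that for each terminal `u` some `p`-coloring uses only `s`
colors on `U \ {u}`. Take two gadgets with parameters `t₁ + t₂ = p - 1` and join their terminals
completely. Then `U₁` and `U₂` together need more than `p` colors, so the result is not
`p`-colorable; but deleting an edge `u v` with `u ∈ U₁` and `v ∈ U₂` allows `u` and `v` to share a
color, so that `t₁ + t₂ + 1 = p` colors suffice. Hence every critical subgraph contains the whole
complete bipartite graph between `U₁` and `U₂` (`Gadget.exists_obstruction`). It has odd girth
greater than `5` provided that the two parts have, and that no walk of length `3` joins two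
terminals of the same part.

Gadgets arise as follows.

* If `G` is `p`-critical, add for every vertex `v` a shadow, adjacent to the neighbors of `v`. The
  shadows receive all `p` colors, since otherwise the vertices of a missing color could be recolored
  by the colors of their shadows (`shadowGadget`). Passing to a minimal set of shadows yields
  gadgets for all smaller `s` (`Gadget.exists_of_le`).
* For `t` gadgets whose terminals hit every set of `t`, `t - 1`, ..., `1` colors respectively, add a
  new vertex for every tuple of terminals. A set of `t` colors is hit entirely by some tuple, so the
  tuples are the terminals of a new gadget with parameter `t` (`Gadget.prod`). No walk of length `3`
  joins them. For `t ≥ 2` there are far more tuples than other vertices.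

With `p = k - 1` and `t₁ = t₂ = 1` one gets two odd cycles of length `m`, each with shadows and
pendant vertices, and the density `m ^ 2 / (6 * m) ^ 2 = 1 / 36` for `k = 4`. For `k ≥ 6` both
parameters can be at least `2`, almost all vertices are terminals, and the density approaches the
bound `1 / 4` of Mantel's theorem. For `k = 5` the parameters are `1` and `2`. The part with
parameter `1` comes from a dense `4`-critical graph of order `N` with at least `N ^ 2 / 36` edges,
each of which yields three critical edges of the new graph; with `17 * N / 6` terminals on the
other side the density approaches `(17 / 6 + 3 / 36) / (3 + 17 / 6) ^ 2 = 3 / 35`. To balance the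
two sides one uses that the orders of the critical graphs obtained have bounded gaps
(`exists_obstruction_order`).
-/

/-! ### Graphs without short odd closed walks -/

/-- `G` has no closed walk of length `3` or `5`; equivalently, its odd girth exceeds `5`. -/
def SimpleGraph.NoShortOdd {V : Type*} (G : SimpleGraph V) : Prop :=
  (∀ a b c, G.Adj a b → G.Adj b c → G.Adj c a → False) ∧
  ∀ a b c d e, G.Adj a b → G.Adj b c → G.Adj c d → G.Adj d e → G.Adj e a → False

namespace SimpleGraph

variable {V W K : Type*}

theorem NoShortOdd.comap {G : SimpleGraph V} {H : SimpleGraph W} (hH : H.NoShortOdd) (f : V → W)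
    (hf : ∀ a b, G.Adj a b → H.Adj (f a) (f b)) : G.NoShortOdd :=
  ⟨fun _ _ _ h₁ h₂ h₃ => hH.1 _ _ _ (hf _ _ h₁) (hf _ _ h₂) (hf _ _ h₃),
    fun _ _ _ _ _ h₁ h₂ h₃ h₄ h₅ =>
      hH.2 _ _ _ _ _ (hf _ _ h₁) (hf _ _ h₂) (hf _ _ h₃) (hf _ _ h₄) (hf _ _ h₅)⟩

theorem NoShortOdd.lt_oddGirth {G : SimpleGraph V} (hG : G.NoShortOdd) :
    (5 : ℕ∞) < G.oddGirth := by
  have key : ∀ (v : V) (w : G.Walk v v), w.IsCycle → Odd w.length → 6 ≤ w.length := by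
    intro v w hw hodd
    by_contra! hlt
    have h3 := hw.three_le_length
    have h35 : w.length = 3 ∨ w.length = 5 := by
      obtain ⟨k, hk⟩ := hodd
      omega
    rcases h35 with h | h
    · match w, h with
      | .cons h₁ (.cons h₂ (.cons h₃ .nil)), _ => exact hG.1 _ _ _ h₁ h₂ h₃
    · match w, h with
      | .cons h₁ (.cons h₂ (.cons h₃ (.cons h₄ (.cons h₅ .nil)))), _ =>
        exact hG.2 _ _ _ _ _ h₁ h₂ h₃ h₄ h₅
  refine lt_of_lt_of_le (b := (6 : ℕ∞)) (by norm_num) ?_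
  unfold oddGirth
  refine le_iInf fun v => le_iInf fun w => le_iInf fun hw => le_iInf fun hodd => ?_
  exact_mod_cast key v w hw hodd

theorem cliqueFree_three_of_lt_oddGirth {G : SimpleGraph V} (hG : (5 : ℕ∞) < G.oddGirth) :
    G.CliqueFree 3 := by
  classical
  intro s hs
  obtain ⟨v, w, hw, hlen⟩ := is3Clique_iff_exists_cycle_length_three.1 ⟨s, hs⟩
  have : G.oddGirth ≤ (w.length : ℕ∞) :=
    (iInf_le _ v).trans <| (iInf_le _ w).trans <| (iInf_le _ hw).trans <|
      iInf_le _ (by rw [hlen]; decide)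
  rw [hlen] at this
  exact absurd (lt_of_lt_of_le hG this) (by norm_num)

/-! ### Colorings by functions -/

theorem colorable_iff_exists_fun {G : SimpleGraph V} {q : ℕ} :
    G.Colorable q ↔ ∃ c : V → Fin q, ∀ a b, G.Adj a b → c a ≠ c b :=
  ⟨fun ⟨C⟩ => ⟨C, fun _ _ h => C.valid h⟩, fun ⟨c, h⟩ => ⟨Coloring.mk c fun {a b} => h a b⟩⟩

theorem colorable_of_forall_mem {G : SimpleGraph V} {q : ℕ} {P : Finset K} (hP : P.card ≤ q)
    (c : V → K) (hc : ∀ a b, G.Adj a b → c a ≠ c b) (hcP : ∀ a, c a ∈ P) : G.Colorable q := by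
  have C : G.Coloring P := Coloring.mk (fun v => ⟨c v, hcP v⟩) fun {a b} h => by
    simpa using hc a b h
  exact (by simpa using C.colorable : G.Colorable P.card).mono hP

theorem Colorable.exists_fun_mem {G : SimpleGraph V} {q : ℕ} (hG : G.Colorable q) {P : Finset K}
    (hP : P.card = q) : ∃ c : V → K, (∀ a, c a ∈ P) ∧ ∀ a b, G.Adj a b → c a ≠ c b := by
  obtain ⟨c, hc⟩ := colorable_iff_exists_fun.1 hG
  let e := P.equivFinOfCardEq hP
  exact ⟨fun a => (e.symm (c a) : K), fun a => (e.symm (c a)).2, fun a b h hab =>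
    hc a b h (e.symm.injective (Subtype.ext hab))⟩

/-- An edge-critical `(q + 1)`-chromatic graph of odd girth greater than `5` without isolated
vertices. -/
structure IsObstruction (q : ℕ) (G : SimpleGraph V) : Prop where
  not_colorable : ¬ G.Colorable q
  colorable_deleteEdges : ∀ v w, G.Adj v w → (G.deleteEdges {s(v, w)}).Colorable q
  exists_adj : ∀ v, ∃ w, G.Adj v w
  noShortOdd : G.NoShortOdd

/-- Coloring an obstruction minus an edge. -/
theorem IsObstruction.exists_fun {q : ℕ} {G : SimpleGraph V} (hG : G.IsObstruction q)
    {P : Finset K} (hP : P.card = q) {v w : V} (h : G.Adj v w) :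
    ∃ c : V → K, (∀ a, c a ∈ P) ∧ ∀ a b, G.Adj a b → c a = c b → s(a, b) = s(v, w) := by
  obtain ⟨c, hcP, hc⟩ := (hG.colorable_deleteEdges v w h).exists_fun_mem hP
  refine ⟨c, hcP, fun a b hab heq => ?_⟩
  by_contra hne
  exact hc a b (by simp [deleteEdges_adj, hab, hne]) heq

/-- An obstruction has a coloring in which a prescribed color is used at a prescribed vertex
only. -/
theorem IsObstruction.exists_fun_special {q : ℕ} {G : SimpleGraph V} (hG : G.IsObstruction q)
    {P : Finset K} (hP : P.card = q) {x : K} (hx : x ∉ P) (v : V) :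
    ∃ c : V → K, c v = x ∧ (∀ a, a ≠ v → c a ∈ P) ∧ ∀ a b, G.Adj a b → c a ≠ c b := by
  classical
  obtain ⟨w, hw⟩ := hG.exists_adj v
  obtain ⟨c, hcP, hc⟩ := hG.exists_fun hP hw
  refine ⟨Function.update c v x, by simp, fun a ha => by simp [ha, hcP], fun a b hab heq => ?_⟩
  by_cases ha : a = v
  · subst ha
    rw [Function.update_self, Function.update_of_ne hab.ne'] at heq
    exact hx (heq ▸ hcP b)
  by_cases hb : b = v
  · subst hb
    rw [Function.update_self, Function.update_of_ne ha] at heq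
    exact hx (heq ▸ hcP a)
  rw [Function.update_of_ne ha, Function.update_of_ne hb] at heq
  have := hc a b hab heq
  rw [Sym2.eq_iff] at this
  tauto

end SimpleGraph

/-! ### Gadgets -/

/-- A finite graph of odd girth greater than `5` with an independent set `U` of vertices, the
*terminals*, such that no coloring with `p` colors uses at most `s` colors on `U`
(field `forces`), while for every terminal `u` some coloring uses only `s` prescribed colors
on `U \ {u}` and one further prescribed color at `u` (field `crit`). -/
structure Gadget (p s : ℕ) where
  /-- the type of vertices -/
  X : Type
  [fintype : Fintype X]
  /-- the graph -/
  graph : SimpleGraph X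
  /-- the set of terminals -/
  U : Set X
  nonempty_U : U.Nonempty
  forces : ∀ c : X → Fin p, (∀ a b, graph.Adj a b → c a ≠ c b) →
    ∀ S : Finset (Fin p), S.card = s → ∃ u ∈ U, c u ∉ S
  crit : ∀ u ∈ U, ∀ S : Finset (Fin p), S.card = s → ∀ x, x ∉ S →
    ∃ c : X → Fin p, (∀ a b, graph.Adj a b → c a ≠ c b) ∧ c u = x ∧
      ∀ u' ∈ U, u' ≠ u → c u' ∈ S
  noShortOdd : graph.NoShortOdd
  indep : ∀ u ∈ U, ∀ v ∈ U, ¬ graph.Adj u v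

attribute [instance] Gadget.fintype

namespace Gadget

/-- No walk of length `3` joins two terminals. -/
def Far {p s : ℕ} (g : Gadget p s) : Prop :=
  ∀ u ∈ g.U, ∀ v ∈ g.U, ∀ x y, g.graph.Adj u x → g.graph.Adj x y → g.graph.Adj y v → False

/-- The edges after whose deletion some coloring uses only `s` prescribed colors on the
terminals. -/
def Releasable {p s : ℕ} (g : Gadget p s) : Set (Sym2 g.X) :=
  {e | e ∈ g.graph.edgeSet ∧ ∀ S : Finset (Fin p), S.card = s →
    ∃ c : g.X → Fin p, (∀ a b, g.graph.Adj a b → c a = c b → s(a, b) = e) ∧ ∀ u ∈ g.U, c u ∈ S}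

end Gadget

/-! ### The shadow gadget of an obstruction -/

/-- Two copies of the vertices of `G`: the first carries `G`, and the second one, the shadows,
is independent, the shadow of `v` being adjacent to the neighbors of `v`. -/
def shadowGraph {V : Type*} (G : SimpleGraph V) : SimpleGraph (V ⊕ V) where
  Adj
    | .inl a, .inl b => G.Adj a b
    | .inl a, .inr b => G.Adj a b
    | .inr a, .inl b => G.Adj a b
    | .inr _, .inr _ => False
  symm := ⟨by rintro (a | a) (b | b) h <;> first | exact h | exact G.symm.symm _ _ h⟩
  loopless := ⟨by rintro (a | a) h <;> first | exact h | exact G.loopless.irrefl _ h⟩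

section shadow

variable {V : Type*} {G : SimpleGraph V}

@[simp] theorem shadowGraph_inl_inl {a b : V} :
    (shadowGraph G).Adj (.inl a) (.inl b) ↔ G.Adj a b := Iff.rfl
@[simp] theorem shadowGraph_inr_inr {a b : V} :
    ¬ (shadowGraph G).Adj (.inr a) (.inr b) := id

theorem three_mul_card_edgeSet_le_shadowGraph [Fintype V] :
    3 * G.edgeSet.ncard ≤ (shadowGraph G).edgeSet.ncard := by
  classical
  let f : G.Dart ⊕ G.Dart ⊕ G.Dart → (shadowGraph G).Dart
    | .inl d => ⟨(.inl d.fst, .inl d.snd), d.adj⟩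
    | .inr (.inl d) => ⟨(.inl d.fst, .inr d.snd), d.adj⟩
    | .inr (.inr d) => ⟨(.inr d.fst, .inl d.snd), d.adj⟩
  have hf : Function.Injective f := by
    rintro (d | d | d) (d' | d' | d') h <;>
      simp_all [f, SimpleGraph.Dart.ext_iff, Prod.ext_iff]
  have h := Fintype.card_le_of_injective f hf
  simp only [Fintype.card_sum, SimpleGraph.dart_card_eq_twice_card_edges] at h
  rw [← SimpleGraph.coe_edgeFinset, ← SimpleGraph.coe_edgeFinset, Set.ncard_coe_finset,
    Set.ncard_coe_finset]
  omega

/-- A `q`-coloring of `G` minus an edge extends to the shadow graph minus any edge that lies over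
this edge, with the additional color `x` not used on the shadows. -/
theorem SimpleGraph.IsObstruction.exists_fun_shadow {K : Type*} {q : ℕ} (hG : G.IsObstruction q)
    {P : Finset K} (hP : P.card = q) {x : K} (hx : x ∉ P) {e : Sym2 (V ⊕ V)}
    (he : e ∈ (shadowGraph G).edgeSet) :
    ∃ c : V ⊕ V → K, (∀ a b, (shadowGraph G).Adj a b → c a = c b → s(a, b) = e) ∧
      ∀ v, c (.inr v) ∈ P := by
  classical
  induction e with | _ a b
  wlog hab : ∃ v, a = .inl v generalizing a b
  · obtain ⟨v, rfl⟩ : ∃ v, a = .inr v := by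
      rcases a with a | a
      · exact absurd ⟨a, rfl⟩ hab
      · exact ⟨a, rfl⟩
    rcases b with b | b
    · rw [Sym2.eq_swap] at he ⊢
      exact this _ _ he ⟨b, rfl⟩
    · exact absurd ((SimpleGraph.mem_edgeSet _).1 he) shadowGraph_inr_inr
  obtain ⟨v, rfl⟩ := hab
  rw [SimpleGraph.mem_edgeSet] at he
  rcases b with w | w
  · -- both ends of a deleted edge of `G` get the color `x`
    obtain ⟨c, hcP, hc⟩ := hG.exists_fun hP (he : G.Adj v w)
    have hxc : ∀ a, x ≠ c a := fun a h => hx (h ▸ hcP a)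
    refine ⟨Sum.elim (fun a => if a = v ∨ a = w then x else c a) c, ?_, fun a => hcP a⟩
    rintro (a | a) (b | b) hab heq
    · have hne : a ≠ b := (shadowGraph_inl_inl.1 hab).ne
      simp only [Sum.elim_inl] at heq
      have h1 := hc a b hab
      simp only [Sym2.eq_iff, Sum.inl.injEq] at h1 ⊢
      have := hxc a; have := hxc b
      split_ifs at heq <;> grind
    · simp only [Sum.elim_inl, Sum.elim_inr] at heq
      have h1 := hc a b hab
      simp only [Sym2.eq_iff] at h1
      have := hxc b
      split_ifs at heq <;> grind
    · simp only [Sum.elim_inl, Sum.elim_inr] at heq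
      have h1 := hc a b hab
      simp only [Sym2.eq_iff] at h1
      have := hxc a
      split_ifs at heq <;> grind
    · exact absurd hab shadowGraph_inr_inr
  · -- the end of the deleted edge whose shadow is involved gets the color `x`
    obtain ⟨c, hcP, hc⟩ := hG.exists_fun hP (he : G.Adj v w)
    have hxc : ∀ a, x ≠ c a := fun a h => hx (h ▸ hcP a)
    refine ⟨Sum.elim (fun a => if a = w then x else c a) c, ?_, fun a => hcP a⟩
    rintro (a | a) (b | b) hab heq
    · have hne : a ≠ b := (shadowGraph_inl_inl.1 hab).ne
      simp only [Sum.elim_inl] at heq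
      have h1 := hc a b hab
      simp only [Sym2.eq_iff, Sum.inl.injEq] at h1 ⊢
      have := hxc a; have := hxc b
      split_ifs at heq <;> grind
    · simp only [Sum.elim_inl, Sum.elim_inr] at heq
      have h1 := hc a b hab
      simp only [Sym2.eq_iff] at h1 ⊢
      have := hxc b
      split_ifs at heq <;> grind
    · simp only [Sum.elim_inl, Sum.elim_inr] at heq
      have h1 := hc a b hab
      simp only [Sym2.eq_iff] at h1 ⊢
      have := hxc a
      split_ifs at heq <;> grind
    · exact absurd hab shadowGraph_inr_inr

/-- If `G` is not `q`-colorable, then all `q + 1` colors occur on its shadows: otherwise the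
vertices of a missing color could take over the colors of their shadows. -/
theorem exists_shadow_eq {q : ℕ} (hG : ¬ G.Colorable q) (c : V ⊕ V → Fin (q + 1))
    (hc : ∀ a b, (shadowGraph G).Adj a b → c a ≠ c b) (x : Fin (q + 1)) :
    ∃ v, c (.inr v) = x := by
  by_contra! h
  refine hG (SimpleGraph.colorable_of_forall_mem (P := Finset.univ.erase x) (by simp)
    (fun v => if c (.inl v) = x then c (.inr v) else c (.inl v)) (fun a b hab => ?_) fun a => ?_)
  · have h1 := hc (.inl a) (.inl b) hab
    have h2 := hc (.inl a) (.inr b) hab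
    have h3 := hc (.inr a) (.inl b) hab
    split_ifs <;> grind
  · split_ifs with h1
    · simpa using h a
    · simpa using h1

theorem SimpleGraph.NoShortOdd.shadowGraph (hG : G.NoShortOdd) : (shadowGraph G).NoShortOdd := by
  refine hG.comap (Sum.elim id id) ?_
  rintro (a | a) (b | b) h
  · exact h
  · exact h
  · exact h
  · exact h.elim

end shadow

/-- The shadows of an obstruction are the terminals of a gadget. -/
def shadowGadget {V : Type} [Fintype V] {q : ℕ} {G : SimpleGraph V} (hG : G.IsObstruction q) :
    Gadget (q + 1) q where
  X := V ⊕ V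
  graph := shadowGraph G
  U := Set.range Sum.inr
  nonempty_U := by
    by_contra! h
    have : IsEmpty V := by simpa using h
    exact hG.not_colorable (.of_isEmpty q)
  forces c hc S hS := by
    obtain ⟨x, hx⟩ : ∃ x, x ∉ S := by
      by_contra! h
      have := Finset.eq_univ_iff_forall.2 h
      simp [this] at hS
    obtain ⟨v, hv⟩ := exists_shadow_eq hG.not_colorable c hc x
    exact ⟨_, ⟨v, rfl⟩, hv ▸ hx⟩
  crit := by
    rintro _ ⟨v, rfl⟩ S hS x hx
    obtain ⟨c, hcv, hcS, hc⟩ := hG.exists_fun_special hS hx v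
    refine ⟨Sum.elim c c, ?_, hcv, ?_⟩
    · rintro (a | a) (b | b) hab
      · exact hc a b hab
      · exact hc a b hab
      · exact hc a b hab
      · exact hab.elim
    · rintro _ ⟨a, rfl⟩ ha
      exact hcS a (by simpa using ha)
  noShortOdd := hG.noShortOdd.shadowGraph
  indep := by
    rintro _ ⟨u, rfl⟩ _ ⟨v, rfl⟩
    exact shadowGraph_inr_inr

theorem releasable_shadowGadget {V : Type} [Fintype V] {q : ℕ} {G : SimpleGraph V}
    (hG : G.IsObstruction q) : (shadowGadget hG).Releasable = (shadowGraph G).edgeSet := by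
  refine Set.Subset.antisymm (fun e he => he.1) fun e he => ⟨he, fun S hS => ?_⟩
  obtain ⟨x, hx⟩ : ∃ x, x ∉ S := by
    by_contra! h
    have := Finset.eq_univ_iff_forall.2 h
    simp [this] at hS
  obtain ⟨c, hc, hcS⟩ := hG.exists_fun_shadow hS hx he
  refine ⟨c, hc, ?_⟩
  rintro _ ⟨v, rfl⟩
  exact hcS v

theorem exists_mem_shadowGraph {V : Type} {q : ℕ} {G : SimpleGraph V}
    (hG : G.IsObstruction q) (x : V ⊕ V) : ∃ e ∈ (shadowGraph G).edgeSet, x ∈ e := by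
  rcases x with v | v <;> obtain ⟨w, hw⟩ := hG.exists_adj v
  · exact ⟨s(.inl v, .inl w), hw, by simp⟩
  · exact ⟨s(.inr v, .inl w), hw, by simp⟩

/-! ### Fewer forced colors -/

/-- Some permutation maps `S` to `T`, and a given point outside `S` to one outside `T`. -/
theorem exists_perm_of_card_eq {α : Type*} [Fintype α] [DecidableEq α] {S T : Finset α}
    (h : S.card = T.card) {x y : α} (hx : x ∉ S) (hy : y ∉ T) :
    ∃ π : Equiv.Perm α, (∀ a ∈ S, π a ∈ T) ∧ π x = y := by
  let e : {a // a ∈ S} ≃ {a // a ∈ T} := Finset.equivOfCardEq h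
  have hx' : e.extendSubtype x ∉ T := e.extendSubtype_not_mem x hx
  refine ⟨e.extendSubtype.trans (Equiv.swap (e.extendSubtype x) y), fun a ha => ?_, by simp⟩
  have haT : e.extendSubtype a ∈ T := e.extendSubtype_mem a ha
  rw [Equiv.trans_apply, Equiv.swap_apply_of_ne_of_ne]
  · exact haT
  · exact fun h => hx' (h ▸ haT)
  · exact fun h => hy (h ▸ haT)

namespace Gadget

/-- Keeping the graph of a gadget and passing to a minimal set of terminals on which more than
`s'` colors are forced. -/
theorem exists_of_le {p s s' : ℕ} (g : Gadget p s) (hs : s' ≤ s) (hp : s < p) :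
    Nonempty (Gadget p s') := by
  let P : Set g.X → Prop := fun W => ∀ c : g.X → Fin p,
    (∀ a b, g.graph.Adj a b → c a ≠ c b) →
      ∀ S : Finset (Fin p), S.card = s' → ∃ u ∈ W, c u ∉ S
  have hU : P g.U := fun c hc S hS => by
    obtain ⟨S', hSS', -, hS'⟩ := Finset.exists_subsuperset_card_eq (Finset.subset_univ S)
      (hS ▸ hs) (by simpa using hp.le)
    obtain ⟨u, hu, hu'⟩ := g.forces c hc S' hS'
    exact ⟨u, hu, fun h => hu' (hSS' h)⟩
  obtain ⟨W, hWU, hW⟩ := Set.Finite.exists_le_minimal (Set.toFinite {W | P W}) hU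
  refine ⟨{ X := g.X, graph := g.graph, U := W, nonempty_U := ?_, forces := hW.prop, crit := ?_,
            noShortOdd := g.noShortOdd
            indep := fun u hu v hv => g.indep u (hWU hu) v (hWU hv) }⟩
  · obtain ⟨u, hu⟩ := g.nonempty_U
    obtain ⟨S, -, hS⟩ := Finset.exists_subset_card_eq
      (s := (Finset.univ : Finset (Fin p))) (n := s) (by simpa using hp.le)
    obtain ⟨x, hx⟩ := Finset.exists_mem_notMem_of_card_lt_card
      (s := S) (t := Finset.univ) (by simpa [hS] using hp)
    obtain ⟨c, hc, -⟩ := g.crit u hu S hS x hx.2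
    obtain ⟨S', hS', hcard⟩ := Finset.exists_subset_card_eq (s := S) (n := s') (by lia)
    obtain ⟨w, hw, -⟩ := hW.prop c hc S' hcard
    exact ⟨w, hw⟩
  intro u hu S hS x hx
  have hnot : ¬ P (W \ {u}) := fun h => by
    have := hW.le_of_le h Set.sdiff_subset hu
    simp at this
  simp only [P, not_forall, not_exists, not_and, not_not] at hnot
  obtain ⟨c, hc, S₀, hS₀, hcS⟩ := hnot
  obtain ⟨v, hv, hvS⟩ := hW.prop c hc S₀ hS₀
  obtain rfl : v = u := by
    by_contra hne
    exact hvS (hcS v ⟨hv, hne⟩)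
  obtain ⟨π, hπ, hπx⟩ := exists_perm_of_card_eq (hS₀.trans hS.symm) hvS hx
  exact ⟨fun a => π (c a), fun a b hab h => hc a b hab (π.injective h), hπx,
    fun u' hu' hne => hπ _ (hcS u' ⟨hu', hne⟩)⟩

end Gadget

/-! ### Products of gadgets -/

/-- The disjoint union of graphs `Γ i`, together with a new vertex for every tuple `f` of
vertices `f i ∈ U i`, which is adjacent to the members of the tuple. -/
def tupleGraph {ι : Type*} {X : ι → Type*} (Γ : ∀ i, SimpleGraph (X i)) (U : ∀ i, Set (X i)) :
    SimpleGraph ((Σ i, X i) ⊕ (∀ i, U i)) where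
  Adj
    | .inl a, .inl b => ∃ i u v, (Γ i).Adj u v ∧ a = ⟨i, u⟩ ∧ b = ⟨i, v⟩
    | .inl a, .inr f => (f a.1 : X a.1) = a.2
    | .inr f, .inl a => (f a.1 : X a.1) = a.2
    | .inr _, .inr _ => False
  symm := ⟨by
    rintro (a | a) (b | b) h
    · obtain ⟨i, u, v, h, rfl, rfl⟩ := h
      exact ⟨i, v, u, h.symm, rfl, rfl⟩
    · exact h
    · exact h
    · exact h⟩
  loopless := ⟨by
    rintro (a | a) h
    · obtain ⟨i, u, v, h, rfl, h'⟩ := h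
      cases h'
      exact h.ne rfl
    · exact h⟩

section tuple

variable {ι : Type*} {X : ι → Type*} {Γ : ∀ i, SimpleGraph (X i)} {U : ∀ i, Set (X i)}

theorem tupleGraph_inl_inl {a b : Σ i, X i} : (tupleGraph Γ U).Adj (.inl a) (.inl b) ↔
    ∃ i u v, (Γ i).Adj u v ∧ a = ⟨i, u⟩ ∧ b = ⟨i, v⟩ := Iff.rfl
theorem tupleGraph_inl_inr {a : Σ i, X i} {f : ∀ i, U i} :
    (tupleGraph Γ U).Adj (.inl a) (.inr f) ↔ (f a.1 : X a.1) = a.2 := Iff.rfl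
theorem tupleGraph_inr_inl {a : Σ i, X i} {f : ∀ i, U i} :
    (tupleGraph Γ U).Adj (.inr f) (.inl a) ↔ (f a.1 : X a.1) = a.2 := Iff.rfl
theorem tupleGraph_inr_inr {f g : ∀ i, U i} :
    ¬ (tupleGraph Γ U).Adj (.inr f) (.inr g) := id

theorem tupleGraph_fiber {i : ι} {u v : X i} :
    (tupleGraph Γ U).Adj (.inl ⟨i, u⟩) (.inl ⟨i, v⟩) ↔ (Γ i).Adj u v := by
  rw [tupleGraph_inl_inl]
  constructor
  · rintro ⟨j, u', v', h, h1, h2⟩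
    cases h1
    cases h2
    exact h
  · exact fun h => ⟨i, u, v, h, rfl, rfl⟩

/-- Along an edge between two vertices that are not tuples, the component is constant. -/
theorem tupleGraph_fst {a b : Σ i, X i} (h : (tupleGraph Γ U).Adj (.inl a) (.inl b)) :
    a.1 = b.1 := by
  obtain ⟨i, u, v, -, rfl, rfl⟩ := h
  rfl

theorem tupleGraph_noShort_inl (hΓ : ∀ i, (Γ i).NoShortOdd) :
    ((tupleGraph Γ U).comap Sum.inl).NoShortOdd := by
  constructor
  · rintro ⟨i, a⟩ ⟨j, b⟩ ⟨k, c⟩ h1 h2 h3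
    obtain rfl : i = j := tupleGraph_fst (U := U) h1
    obtain rfl : i = k := tupleGraph_fst (U := U) h2
    have fib := @tupleGraph_fiber _ _ Γ U i
    exact (hΓ i).1 a b c (fib.1 h1) (fib.1 h2) (fib.1 h3)
  · rintro ⟨i, a⟩ ⟨j, b⟩ ⟨k, c⟩ ⟨l, d⟩ ⟨m, e⟩ h1 h2 h3 h4 h5
    obtain rfl : i = j := tupleGraph_fst (U := U) h1
    obtain rfl : i = k := tupleGraph_fst (U := U) h2
    obtain rfl : i = l := tupleGraph_fst (U := U) h3
    obtain rfl : i = m := tupleGraph_fst (U := U) h4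
    have fib := @tupleGraph_fiber _ _ Γ U i
    exact (hΓ i).2 a b c d e (fib.1 h1) (fib.1 h2) (fib.1 h3) (fib.1 h4) (fib.1 h5)

/-- Two neighbors of the same tuple lie in different components or coincide. -/
theorem tupleGraph_eq_of_fst_eq {a b : Σ i, X i} {f : ∀ i, U i} (hab : a.1 = b.1)
    (ha : (f a.1 : X a.1) = a.2) (hb : (f b.1 : X b.1) = b.2) : a = b := by
  obtain ⟨i, a⟩ := a
  obtain ⟨j, b⟩ := b
  obtain rfl : i = j := hab
  exact congrArg (Sigma.mk i) (ha.symm.trans hb)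

/-- Neighbors of tuples are not adjacent. -/
theorem tupleGraph_not_adj (hU : ∀ i, ∀ u ∈ U i, ∀ v ∈ U i, ¬ (Γ i).Adj u v)
    {a b : Σ i, X i} {f g : ∀ i, U i} (ha : (f a.1 : X a.1) = a.2)
    (hb : (g b.1 : X b.1) = b.2) : ¬ (tupleGraph Γ U).Adj (.inl a) (.inl b) := by
  rintro ⟨i, u, v, h, rfl, rfl⟩
  have hu : (f i : X i) = u := ha
  have hv : (g i : X i) = v := hb
  exact hU i u (hu ▸ (f i).2) v (hv ▸ (g i).2) h

theorem tupleGraph_noShortOdd (hΓ : ∀ i, (Γ i).NoShortOdd)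
    (hU : ∀ i, ∀ u ∈ U i, ∀ v ∈ U i, ¬ (Γ i).Adj u v) : (tupleGraph Γ U).NoShortOdd := by
  have hin := tupleGraph_noShort_inl (U := U) hΓ
  have hnot := @tupleGraph_not_adj _ _ Γ U hU
  -- a closed walk of length 5 with exactly one tuple shortcuts to a triangle
  have h5 : ∀ (f : ∀ i, U i) (a b c d : Σ i, X i), (f a.1 : X a.1) = a.2 →
      (tupleGraph Γ U).Adj (.inl a) (.inl b) → (tupleGraph Γ U).Adj (.inl b) (.inl c) →
      (tupleGraph Γ U).Adj (.inl c) (.inl d) → (f d.1 : X d.1) = d.2 → False := by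
    intro f a b c d ha h1 h2 h3 hd
    obtain rfl := tupleGraph_eq_of_fst_eq
      ((tupleGraph_fst h1).trans ((tupleGraph_fst h2).trans (tupleGraph_fst h3))) ha hd
    exact hin.1 a b c h1 h2 h3
  constructor
  · rintro (a | a) (b | b) (c | c) h1 h2 h3
    · exact hin.1 a b c h1 h2 h3
    · exact hnot h3 h2 h1
    · exact hnot h2 h1 h3
    · exact h2
    · exact hnot h1 h3 h2
    · exact h3
    · exact h1
    · exact h1
  · rintro (a | a) (b | b) (c | c) (d | d) (e | e) h1 h2 h3 h4 h5'
    all_goals first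
      | exact tupleGraph_inr_inr h1 | exact tupleGraph_inr_inr h2
      | exact tupleGraph_inr_inr h3 | exact tupleGraph_inr_inr h4
      | exact tupleGraph_inr_inr h5'
      | exact hin.2 a b c d e h1 h2 h3 h4 h5'
      | exact h5 a b c d e h1 h2 h3 h4 h5'
      | exact h5 b c d e a h2 h3 h4 h5' h1
      | exact h5 c d e a b h3 h4 h5' h1 h2
      | exact h5 d e a b c h4 h5' h1 h2 h3
      | exact h5 e a b c d h5' h1 h2 h3 h4
      | exact hnot h5' h2 h1 | exact hnot h1 h3 h2 | exact hnot h2 h4 h3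
      | exact hnot h3 h5' h4 | exact hnot h4 h1 h5'

theorem tupleGraph_far (hU : ∀ i, ∀ u ∈ U i, ∀ v ∈ U i, ¬ (Γ i).Adj u v) (f g : ∀ i, U i)
    (x y) (h1 : (tupleGraph Γ U).Adj (.inr f) x) (h2 : (tupleGraph Γ U).Adj x y)
    (h3 : (tupleGraph Γ U).Adj y (.inr g)) : False := by
  rcases x with x | x
  · rcases y with y | y
    · exact tupleGraph_not_adj hU h1 h3 h2
    · exact h3
  · exact h1

/-- Colorings of the graphs `Γ i` extend to the tuples if every tuple finds a color that none of
its members has. The edges in `E` may be monochromatic. -/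
theorem tupleGraph_proper {K : Type*} (E : Set (Sym2 ((Σ i, X i) ⊕ (∀ i, U i))))
    (c : ∀ i, X i → K) (d : (∀ i, U i) → K)
    (hc : ∀ i a b, (Γ i).Adj a b → c i a = c i b → s(.inl ⟨i, a⟩, .inl ⟨i, b⟩) ∈ E)
    (hd : ∀ f i, c i (f i) ≠ d f) (a b) (hab : (tupleGraph Γ U).Adj a b)
    (h : Sum.elim (fun a : Σ i, X i => c a.1 a.2) d a =
      Sum.elim (fun a : Σ i, X i => c a.1 a.2) d b) : s(a, b) ∈ E := by
  rcases a with a | f <;> rcases b with b | g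
  · obtain ⟨i, u, v, huv, rfl, rfl⟩ := hab
    exact hc i u v huv h
  · rw [tupleGraph_inl_inr] at hab
    exact absurd (hab ▸ h) (hd g a.1)
  · rw [tupleGraph_inr_inl] at hab
    exact absurd (hab ▸ h.symm) (hd f b.1)
  · exact hab.elim

end tuple

/-- If level `i` hits every set of `t - i` colors, then a set `S` of `t` colors is hit entirely by
choosing one color at each level. -/
theorem exists_hitting {K : Type*} [DecidableEq K] [Nonempty K] (t : ℕ) (R : ℕ → K → Prop)
    (hR : ∀ i < t, ∀ S : Finset K, S.card = t - i → ∃ x ∈ S, R i x) (S : Finset K)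
    (hS : S.card = t) : ∃ g : ℕ → K, (∀ i < t, R i (g i)) ∧ ∀ x ∈ S, ∃ i < t, g i = x := by
  induction t generalizing R S with
  | zero => exact ⟨fun _ => Classical.arbitrary K, by simp, by simp_all⟩
  | succ t ih =>
    obtain ⟨x, hxS, hx⟩ := hR 0 (by simp) S (by simpa using hS)
    obtain ⟨g, hg, hgS⟩ := ih (fun i => R (i + 1))
      (fun i hi S hS => hR (i + 1) (by lia) S (by lia)) (S.erase x)
      (by rw [Finset.card_erase_of_mem hxS]; lia)
    refine ⟨fun i => Nat.casesOn i x g, fun i hi => ?_, fun y hy => ?_⟩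
    · cases i with
      | zero => exact hx
      | succ i => exact hg i (by lia)
    · by_cases hyx : y = x
      · exact ⟨0, by simp, hyx.symm⟩
      · obtain ⟨i, hi, h⟩ := hgS y (Finset.mem_erase.2 ⟨hyx, hy⟩)
        exact ⟨i + 1, by lia, h⟩

/-- If `w i ≠ e j` for all `j > i` and `w m ≠ e m`, then `w` misses one of the colors `e j`: only
the `t - m - 1` indices `i > m` can account for the `t - m` colors `e j` with `j ≥ m`. -/
theorem exists_missing {K : Type*} {t : ℕ} (e : Fin t → K)
    (he : Function.Injective e) (w : Fin t → K) (hw : ∀ i j, i < j → w i ≠ e j) (m : Fin t)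
    (hm : w m ≠ e m) : ∃ j, ∀ i, w i ≠ e j := by
  classical
  by_contra! h
  have hsub : (Finset.Ici m).image e ⊆ (Finset.Ioi m).image w := by
    intro x hx
    obtain ⟨j, hj, rfl⟩ := Finset.mem_image.1 hx
    obtain ⟨i, hi⟩ := h j
    have hji : j ≤ i := not_lt.1 fun hlt => hw i j hlt hi
    have hmj : m ≤ j := Finset.mem_Ici.1 hj
    refine Finset.mem_image.2 ⟨i, Finset.mem_Ioi.2 (lt_of_le_of_ne (hmj.trans hji) ?_), hi⟩
    rintro rfl
    obtain rfl := le_antisymm hji hmj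
    exact hm hi
  have h1 := Finset.card_le_card hsub
  rw [Finset.card_image_of_injective _ he] at h1
  have h2 := (Finset.card_image_le (s := Finset.Ioi m) (f := w))
  simp only [Fin.card_Ici, Fin.card_Ioi] at h1 h2
  have := m.2
  omega

/-- The product of gadgets: the `i`-th factor forces more than `r + i` of the `r + t` colors, so
that its terminals hit every set of `t - i` colors. Hence every set of `t` colors is hit entirely
by some tuple, which then must be colored otherwise. -/
noncomputable def Gadget.prod (r t : ℕ) (g : ∀ i : Fin t, Gadget (r + t) (r + i)) :
    Gadget (r + t) t where
  X := (Σ i, (g i).X) ⊕ (∀ i, (g i).U)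
  fintype := by classical exact @instFintypeSum _ _ _ (Fintype.ofFinite _)
  graph := tupleGraph (fun i => (g i).graph) (fun i => (g i).U)
  U := Set.range Sum.inr
  nonempty_U := ⟨_, fun i => ⟨_, (g i).nonempty_U.some_mem⟩, rfl⟩
  forces := by
    intro c hc S hS
    rcases Nat.eq_zero_or_pos t with rfl | ht
    · exact ⟨.inr (fun i => i.elim0), ⟨_, rfl⟩, by simp_all⟩
    have : Nonempty (Fin (r + t)) := ⟨⟨0, by lia⟩⟩
    obtain ⟨h, hh, hhS⟩ := exists_hitting t
      (fun i x => ∀ hi : i < t, ∃ u ∈ (g ⟨i, hi⟩).U, c (.inl ⟨⟨i, hi⟩, u⟩) = x)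
      (fun i hi R hR => by
        obtain ⟨u, hu, huR⟩ := (g ⟨i, hi⟩).forces (fun u => c (.inl ⟨⟨i, hi⟩, u⟩))
          (fun a b hab => hc _ _ (tupleGraph_fiber.2 hab)) Rᶜ
          (by simp only [Finset.card_compl, Fintype.card_fin, hR]; lia)
        exact ⟨_, by simpa using huR, fun _ => ⟨u, hu, rfl⟩⟩) S hS
    choose u hu hcu using fun i : Fin t => hh i i.2 i.2
    refine ⟨.inr (fun i => ⟨u i, hu i⟩), ⟨_, rfl⟩, fun hmem => ?_⟩
    obtain ⟨i, hi, hx⟩ := hhS _ hmem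
    refine hc (.inl ⟨⟨i, hi⟩, u ⟨i, hi⟩⟩) (.inr (fun i => ⟨u i, hu i⟩)) rfl ?_
    rw [← hx]
    exact hcu ⟨i, hi⟩
  crit := by
    classical
    rintro _ ⟨f, rfl⟩ S hS x hx
    let e' := S.equivFinOfCardEq hS
    let e : Fin t → Fin (r + t) := fun i => e'.symm i
    have he : Function.Injective e := fun i j h => e'.symm.injective (Subtype.ext h)
    have heS : ∀ i, e i ∈ S := fun i => (e'.symm i).2
    have hcol : ∀ i : Fin t, ∃ c : (g i).X → Fin (r + t),
        (∀ a b, (g i).graph.Adj a b → c a ≠ c b) ∧ c (f i) = e i ∧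
          ∀ u' ∈ (g i).U, u' ≠ f i → c u' ∈ ((Finset.Ici i).image e)ᶜ := by
      intro i
      refine (g i).crit (f i) (f i).2 _ ?_ _ (by simpa using ⟨i, le_rfl, rfl⟩)
      rw [Finset.card_compl, Finset.card_image_of_injective _ he, Fin.card_Ici, Fintype.card_fin]
      have := i.2
      omega
    choose c hc hcf hcS using hcol
    have hmiss : ∀ f' : ∀ i, (g i).U, ∃ y, (∀ i, c i (f' i) ≠ y) ∧ (f' = f → y = x) ∧
        (f' ≠ f → y ∈ S) := by
      intro f'
      by_cases hf : f' = f
      · subst hf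
        exact ⟨x, fun i h => hx (h ▸ hcf i ▸ heS i), fun _ => rfl, fun h => absurd rfl h⟩
      · obtain ⟨m, hm⟩ := Function.ne_iff.1 hf
        have havoid : ∀ i, ∀ j, i ≤ j → f' i ≠ f i → c i (f' i) ≠ e j := fun i j hij hne h => by
          have := hcS i (f' i) (f' i).2 (fun h => hne (Subtype.ext h))
          rw [h] at this
          simp only [Finset.mem_compl, Finset.mem_image, Finset.mem_Ici, not_exists,
            not_and] at this
          exact this j hij rfl
        obtain ⟨j, hj⟩ := exists_missing e he (fun i => c i (f' i)) (fun i j hij => by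
          by_cases hne : f' i = f i
          · rw [hne, hcf]
            exact fun h => hij.ne (he h)
          · exact havoid i j hij.le hne) m (havoid m m le_rfl hm)
        exact ⟨e j, hj, fun h => absurd h hf, fun _ => heS j⟩
    choose d hd hdf hdS using hmiss
    refine ⟨Sum.elim (fun a => c a.1 a.2) d, fun a b hab h => ?_, hdf f rfl, ?_⟩
    · exact tupleGraph_proper ∅ c d (fun i a b hab h => absurd h (hc i a b hab)) hd a b hab h
    · rintro _ ⟨f', rfl⟩ hne
      exact hdS f' fun h => hne (h ▸ rfl)
  noShortOdd := tupleGraph_noShortOdd (fun i => (g i).noShortOdd) (fun i => (g i).indep)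
  indep := by
    rintro _ ⟨f, rfl⟩ _ ⟨f', rfl⟩
    exact tupleGraph_inr_inr

namespace Gadget

variable {r t : ℕ} (g : ∀ i : Fin t, Gadget (r + t) (r + i))

theorem far_prod : (prod r t g).Far := by
  rintro _ ⟨f, rfl⟩ _ ⟨f', rfl⟩ x y h1 h2 h3
  exact tupleGraph_far (fun i => (g i).indep) f f' x y h1 h2 h3

theorem ncard_U_prod : (prod r t g).U.ncard = ∏ i, (g i).U.ncard := by
  have : (prod r t g).U.ncard = Nat.card (∀ i, (g i).U) :=
    Set.ncard_range_of_injective Sum.inr_injective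
  rw [this, Nat.card_pi]
  rfl

theorem card_X_prod : Fintype.card (prod r t g).X =
    ∑ i, Fintype.card (g i).X + ∏ i, (g i).U.ncard := by
  have h : Nat.card (prod r t g).X = Nat.card ((Σ i, (g i).X) ⊕ (∀ i, (g i).U)) := rfl
  rw [← Nat.card_eq_fintype_card, h, Nat.card_sum, Nat.card_sigma, Nat.card_pi]
  simp only [Nat.card_eq_fintype_card]
  rfl

/-- Every edge which is releasable in the factor is releasable in a product with one factor: the
terminals of the factor then miss any given color, which suits all tuples. -/
theorem releasable_prod_one {r : ℕ} (g : ∀ i : Fin 1, Gadget (r + 1) (r + i)) :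
    Sym2.map (fun u => Sum.inl ⟨0, u⟩) '' (g 0).Releasable ⊆ (prod r 1 g).Releasable := by
  rintro _ ⟨e, ⟨heE, he⟩, rfl⟩
  refine ⟨?_, fun S hS => ?_⟩
  · induction e with | _ a b
    exact (tupleGraph_fiber (U := fun i => (g i).U)).2 heE
  obtain ⟨x, rfl⟩ := Finset.card_eq_one.1 hS
  obtain ⟨c, hc, hcU⟩ := he {x}ᶜ (by simp [Finset.card_compl])
  have hfin : ∀ i : Fin 1, i = 0 := fun i => Subsingleton.elim _ _
  let c' : ∀ i : Fin 1, (g i).X → Fin (r + 1) := fun i => (hfin i) ▸ c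
  have hc0 : c' 0 = c := rfl
  refine ⟨Sum.elim (fun a => c' a.1 a.2) (fun _ => x), fun a b hab h => ?_, ?_⟩
  · refine tupleGraph_proper {Sym2.map (fun u => Sum.inl ⟨0, u⟩) e} c' (fun _ => x) ?_ ?_ a b hab h
    · intro i a b hab h
      obtain rfl := hfin i
      rw [Set.mem_singleton_iff, ← hc a b hab h]
      rfl
    · intro f i
      obtain rfl := hfin i
      have := hcU (f 0) (f 0).2
      simpa using this
  · rintro _ ⟨f, rfl⟩
    simp

end Gadget

/-! ### Extracting critical graphs -/

/-- There is an obstruction to `q`-colorability with `n` vertices and at least `e` edges. -/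
def ObstructionExists (q n e : ℕ) : Prop :=
  ∃ (V : Type) (_ : Fintype V) (G : SimpleGraph V),
    G.IsObstruction q ∧ Fintype.card V = n ∧ e ≤ G.edgeSet.ncard

/-- A graph that is not `p`-colorable contains an obstruction, and the latter contains every edge
whose deletion makes the graph `p`-colorable. -/
theorem SimpleGraph.exists_obstruction {V : Type} [Fintype V] {p : ℕ} (hp : 0 < p)
    {G : SimpleGraph V} (hG : ¬ G.Colorable p) (hn : G.NoShortOdd) (E : Set (Sym2 V))
    (hE : ∀ e ∈ E, ∃ c : V → Fin p, ∀ a b, G.Adj a b → c a = c b → s(a, b) = e) :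
    ∃ n, n ≤ Fintype.card V ∧ {v | ∃ e ∈ E, v ∈ e}.ncard ≤ n ∧
      ObstructionExists p n E.ncard := by
  classical
  obtain ⟨H, hHG, hH⟩ := Set.Finite.exists_le_minimal
    (Set.toFinite {H : SimpleGraph V | ¬ H.Colorable p}) hG
  have hEH : E ⊆ H.edgeSet := by
    intro e he
    by_contra hne
    obtain ⟨c, hc⟩ := hE e he
    refine hH.prop (colorable_iff_exists_fun.2 ⟨c, fun a b hab heq => hne ?_⟩)
    rw [← hc a b (hHG hab) heq]
    exact hab
  let W : Set V := {v | ∃ w, H.Adj v w}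
  refine ⟨Fintype.card W, Fintype.card_subtype_le _, ?_, W, inferInstance, H.induce W, ?_, rfl, ?_⟩
  · rw [← Nat.card_eq_fintype_card]
    refine Set.ncard_le_ncard (t := W) ?_
    rintro v ⟨e, he, hv⟩
    obtain ⟨w, rfl⟩ := Sym2.mem_iff_exists.1 hv
    exact ⟨w, hEH he⟩
  · refine ⟨fun hcol => ?_, fun v w hvw => ?_, ?_, ?_⟩
    · obtain ⟨c, hc⟩ := colorable_iff_exists_fun.1 hcol
      refine hH.prop (colorable_iff_exists_fun.2
        ⟨fun v => if h : v ∈ W then c ⟨v, h⟩ else ⟨0, hp⟩, fun a b hab => ?_⟩)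
      have ha : a ∈ W := ⟨b, hab⟩
      have hb : b ∈ W := ⟨a, hab.symm⟩
      simpa only [ha, hb, dif_pos] using hc ⟨a, ha⟩ ⟨b, hb⟩ hab
    · have hvw' : H.Adj v w := hvw
      have hlt : (H.deleteEdges {s((v : V), (w : V))}).Colorable p := by
        by_contra hcon
        have h1 := hH.le_of_le hcon (deleteEdges_le _)
        have h2 := h1 hvw'
        simp [deleteEdges_adj] at h2
      obtain ⟨c, hc⟩ := colorable_iff_exists_fun.1 hlt
      refine colorable_iff_exists_fun.2 ⟨fun a => c a, fun a b hab => hc a b ?_⟩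
      rw [deleteEdges_adj] at hab ⊢
      refine ⟨hab.1, fun h => hab.2 ?_⟩
      simp only [Set.mem_singleton_iff, Sym2.eq_iff, Subtype.ext_iff] at h ⊢
      exact h
    · rintro ⟨v, w, hvw⟩
      exact ⟨⟨w, v, hvw.symm⟩, hvw⟩
    · exact hn.comap Subtype.val fun a b hab => hHG hab
  · refine (Set.ncard_le_ncard ?_).trans
      (Set.ncard_image_le (f := Sym2.map (Subtype.val : W → V)) (Set.toFinite _))
    intro e he
    induction e with | _ v w
    have hvw : H.Adj v w := hEH he
    exact ⟨s(⟨v, w, hvw⟩, ⟨w, v, hvw.symm⟩), hvw, rfl⟩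

/-! ### Joining the terminals of two gadgets -/

/-- The disjoint union of two graphs, together with all edges between `U₁` and `U₂`. -/
def bridgeGraph {X₁ X₂ : Type*} (Γ₁ : SimpleGraph X₁) (Γ₂ : SimpleGraph X₂) (U₁ : Set X₁)
    (U₂ : Set X₂) : SimpleGraph (X₁ ⊕ X₂) where
  Adj
    | .inl a, .inl b => Γ₁.Adj a b
    | .inl a, .inr b => a ∈ U₁ ∧ b ∈ U₂
    | .inr a, .inl b => b ∈ U₁ ∧ a ∈ U₂
    | .inr a, .inr b => Γ₂.Adj a b
  symm := ⟨by
    rintro (a | a) (b | b) h <;> first | exact h | exact SimpleGraph.Adj.symm h⟩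
  loopless := ⟨by rintro (a | a) h <;> exact SimpleGraph.irrefl _ h⟩

/-- An odd closed walk through the bridge consists of a path of odd length in one of the parts
between terminals, and one of even length in the other. -/
theorem bridgeGraph_noShortOdd {X₁ X₂ : Type*} {Γ₁ : SimpleGraph X₁} {Γ₂ : SimpleGraph X₂}
    {U₁ : Set X₁} {U₂ : Set X₂} (h₁ : Γ₁.NoShortOdd) (h₂ : Γ₂.NoShortOdd)
    (i₁ : ∀ u ∈ U₁, ∀ v ∈ U₁, ¬ Γ₁.Adj u v) (i₂ : ∀ u ∈ U₂, ∀ v ∈ U₂, ¬ Γ₂.Adj u v)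
    (f₁ : ∀ u ∈ U₁, ∀ v ∈ U₁, ∀ x y, Γ₁.Adj u x → Γ₁.Adj x y → Γ₁.Adj y v → False)
    (f₂ : ∀ u ∈ U₂, ∀ v ∈ U₂, ∀ x y, Γ₂.Adj u x → Γ₂.Adj x y → Γ₂.Adj y v → False) :
    (bridgeGraph Γ₁ Γ₂ U₁ U₂).NoShortOdd := by
  constructor
  · rintro (a | a) (b | b) (c | c) h1 h2 h3 <;> simp only [bridgeGraph] at h1 h2 h3
    · exact h₁.1 _ _ _ h1 h2 h3
    all_goals first
      | exact h₂.1 _ _ _ h1 h2 h3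
      | grind
  · rintro (a | a) (b | b) (c | c) (d | d) (e | e) h1 h2 h3 h4 h5 <;>
      simp only [bridgeGraph] at h1 h2 h3 h4 h5
    · exact h₁.2 _ _ _ _ _ h1 h2 h3 h4 h5
    all_goals first
      | exact h₂.2 _ _ _ _ _ h1 h2 h3 h4 h5
      | grind

/-- Two gadgets that together force more than `p` colors. -/
theorem Gadget.exists_obstruction {p t₁ t₂ : ℕ} (ht : t₁ + t₂ + 1 = p) (g₁ : Gadget p t₁)
    (g₂ : Gadget p t₂) (f₁ : g₁.Far) (f₂ : g₂.Far) :
    ∃ n, n ≤ Fintype.card g₁.X + Fintype.card g₂.X ∧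
      ((∀ x, x ∈ g₁.U ∨ ∃ e ∈ g₁.Releasable, x ∈ e) → Fintype.card g₁.X ≤ n) ∧
      ObstructionExists p n (g₁.U.ncard * g₂.U.ncard + g₁.Releasable.ncard) := by
  classical
  let G := bridgeGraph g₁.graph g₂.graph g₁.U g₂.U
  have hcol : ¬ G.Colorable p := by
    intro hc
    obtain ⟨c, hc⟩ := SimpleGraph.colorable_iff_exists_fun.1 hc
    -- the colors on the two sets of terminals are disjoint
    let S₁ := Finset.univ.filter fun x => ∃ u ∈ g₁.U, c (.inl u) = x
    let S₂ := Finset.univ.filter fun x => ∃ u ∈ g₂.U, c (.inr u) = x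
    have hS₁ : t₁ < S₁.card := by
      by_contra! hle
      obtain ⟨S, hS₁S, -, hS⟩ := Finset.exists_subsuperset_card_eq (Finset.subset_univ S₁) hle
        (by simp; lia)
      obtain ⟨u, hu, hu'⟩ := g₁.forces (fun a => c (.inl a)) (fun a b h => hc _ _ h) S hS
      exact hu' (hS₁S (Finset.mem_filter.2 ⟨Finset.mem_univ _, u, hu, rfl⟩))
    have hS₂ : t₂ < S₂.card := by
      by_contra! hle
      obtain ⟨S, hS₂S, -, hS⟩ := Finset.exists_subsuperset_card_eq (Finset.subset_univ S₂) hle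
        (by simp; lia)
      obtain ⟨u, hu, hu'⟩ := g₂.forces (fun a => c (.inr a)) (fun a b h => hc _ _ h) S hS
      exact hu' (hS₂S (Finset.mem_filter.2 ⟨Finset.mem_univ _, u, hu, rfl⟩))
    have hdisj : Disjoint S₁ S₂ := by
      rw [Finset.disjoint_left]
      intro x hx hx'
      obtain ⟨-, u, hu, rfl⟩ := Finset.mem_filter.1 hx
      obtain ⟨-, v, hv, huv⟩ := Finset.mem_filter.1 hx'
      exact hc (.inl u) (.inr v) ⟨hu, hv⟩ huv.symm
    have := Finset.card_le_univ (S₁ ∪ S₂)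
    rw [Finset.card_union_of_disjoint hdisj, Fintype.card_fin] at this
    omega
  have hn : G.NoShortOdd :=
    bridgeGraph_noShortOdd g₁.noShortOdd g₂.noShortOdd g₁.indep g₂.indep f₁ f₂
  -- the palette splits into `t₁` colors, `t₂` colors and one further color
  obtain ⟨S₁, S₂, x, hS₁, hS₂, hdisj, hx₁, hx₂⟩ : ∃ (S₁ S₂ : Finset (Fin p)) (x : Fin p),
      S₁.card = t₁ ∧ S₂.card = t₂ ∧ Disjoint S₁ S₂ ∧ x ∉ S₁ ∧ x ∉ S₂ := by
    have hp : t₁ + t₂ < p := by lia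
    let x : Fin p := ⟨t₁ + t₂, hp⟩
    obtain ⟨S₁, hsub, hS₁⟩ := Finset.exists_subset_card_eq
      (s := (Finset.univ.erase x)) (n := t₁) (by simp; lia)
    obtain ⟨S₂, hsub', hS₂⟩ := Finset.exists_subset_card_eq
      (s := (Finset.univ.erase x) \ S₁) (n := t₂) (by
        rw [Finset.card_sdiff_of_subset hsub]; simp; lia)
    refine ⟨S₁, S₂, x, hS₁, hS₂, ?_, fun h => ?_, fun h => ?_⟩
    · rw [Finset.disjoint_left]
      exact fun y hy hy' => (Finset.mem_sdiff.1 (hsub' hy')).2 hy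
    · simpa using hsub h
    · simpa using hsub' h
  have hne : ∀ a ∈ S₁, ∀ b ∈ S₂, a ≠ b := fun a ha b hb h =>
    Finset.disjoint_left.1 hdisj ha (h ▸ hb)
  let E₁ : Set (Sym2 (g₁.X ⊕ g₂.X)) :=
    (fun u : g₁.X × g₂.X => s(.inl u.1, .inr u.2)) '' (g₁.U ×ˢ g₂.U)
  let E₂ : Set (Sym2 (g₁.X ⊕ g₂.X)) := Sym2.map Sum.inl '' g₁.Releasable
  have hE : ∀ e ∈ E₁ ∪ E₂, ∃ c : g₁.X ⊕ g₂.X → Fin p,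
      ∀ a b, G.Adj a b → c a = c b → s(a, b) = e := by
    rintro _ (⟨⟨u, v⟩, ⟨hu, hv⟩, rfl⟩ | ⟨e, ⟨-, he⟩, rfl⟩)
    · obtain ⟨c₁, hc₁, hu₁, hU₁⟩ := g₁.crit u hu S₁ hS₁ x hx₁
      obtain ⟨c₂, hc₂, hv₂, hU₂⟩ := g₂.crit v hv S₂ hS₂ x hx₂
      have key : ∀ a ∈ g₁.U, ∀ b ∈ g₂.U, c₁ a = c₂ b → a = u ∧ b = v := by
        intro a ha b hb h
        by_cases hau : a = u <;> by_cases hbv : b = v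
        · exact ⟨hau, hbv⟩
        · subst hau
          exact absurd (hu₁ ▸ h ▸ hU₂ b hb hbv) hx₂
        · subst hbv
          exact absurd (hv₂ ▸ h ▸ hU₁ a ha hau) hx₁
        · exact absurd h (hne _ (hU₁ a ha hau) _ (hU₂ b hb hbv))
      refine ⟨Sum.elim c₁ c₂, ?_⟩
      rintro (a | a) (b | b) hab h
      · exact absurd h (hc₁ a b hab)
      · obtain ⟨rfl, rfl⟩ := key a hab.1 b hab.2 h
        rfl
      · obtain ⟨rfl, rfl⟩ := key b hab.1 a hab.2 h.symm
        exact Sym2.eq_swap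
      · exact absurd h (hc₂ a b hab)
    · obtain ⟨c₁, hc₁, hU₁⟩ := he S₁ hS₁
      obtain ⟨v, hv⟩ := g₂.nonempty_U
      obtain ⟨c₂, hc₂, hv₂, hU₂⟩ := g₂.crit v hv S₂ hS₂ x hx₂
      have key : ∀ a ∈ g₁.U, ∀ b ∈ g₂.U, c₁ a ≠ c₂ b := by
        intro a ha b hb h
        by_cases hbv : b = v
        · subst hbv
          exact hx₁ (hv₂ ▸ h ▸ hU₁ a ha)
        · exact hne _ (hU₁ a ha) _ (hU₂ b hb hbv) h
      refine ⟨Sum.elim c₁ c₂, ?_⟩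
      rintro (a | a) (b | b) hab h
      · rw [← hc₁ a b hab h]
        rfl
      · exact absurd h (key a hab.1 b hab.2)
      · exact absurd h.symm (key b hab.1 a hab.2)
      · exact absurd h (hc₂ a b hab)
  have hcard : (E₁ ∪ E₂).ncard = g₁.U.ncard * g₂.U.ncard + g₁.Releasable.ncard := by
    rw [Set.ncard_union_eq ?_ (Set.toFinite _) (Set.toFinite _), Set.ncard_image_of_injective,
      Set.ncard_image_of_injective _ (Sym2.map.injective Sum.inl_injective), Set.ncard_prod]
    · rintro ⟨a, b⟩ ⟨a', b'⟩ h
      simpa [Sym2.eq_iff] using h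
    · rw [Set.disjoint_left]
      rintro _ ⟨⟨u, v⟩, -, rfl⟩ ⟨e, -, h⟩
      induction e with | _ a b
      simp at h
  obtain ⟨n, hn1, hn2, hn3⟩ := SimpleGraph.exists_obstruction (by lia) hcol hn _ hE
  refine ⟨n, by simpa using hn1, fun hcov => le_trans ?_ hn2, hcard ▸ hn3⟩
  have hsub : Set.range (Sum.inl : g₁.X → g₁.X ⊕ g₂.X) ⊆ {v | ∃ e ∈ E₁ ∪ E₂, v ∈ e} := by
    rintro _ ⟨a, rfl⟩
    rcases hcov a with ha | ⟨e, he, hae⟩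
    · obtain ⟨v, hv⟩ := g₂.nonempty_U
      exact ⟨_, .inl ⟨(a, v), ⟨ha, hv⟩, rfl⟩, by simp⟩
    · exact ⟨_, .inr ⟨e, he, rfl⟩, Sym2.mem_map.2 ⟨a, hae, rfl⟩⟩
  refine le_trans ?_ (Set.ncard_le_ncard hsub)
  rw [Set.ncard_range_of_injective Sum.inl_injective, Nat.card_eq_fintype_card]

/-! ### Odd cycles -/

theorem cycleGraph_noShortOdd {m : ℕ} (hm : 6 ≤ m) :
    (SimpleGraph.cycleGraph (m + 1)).NoShortOdd := by
  have key : ∀ a b : Fin (m + 1), (SimpleGraph.cycleGraph (m + 1)).Adj a b →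
      ∃ δ : ℤ, (δ = 1 ∨ δ = -1) ∧ ((m + 1 : ℕ) : ℤ) ∣ (b.val : ℤ) - a.val - δ := by
    intro a b h
    rw [SimpleGraph.cycleGraph_adj'] at h
    rcases h with h | h
    · refine ⟨-1, .inr rfl, ?_⟩
      rw [Fin.sub_def] at h
      simp only at h
      obtain ⟨k, hk⟩ : ∃ k, m + 1 - b.val + a.val = (m + 1) * k + 1 := by
        have hd := Nat.div_add_mod (m + 1 - b.val + a.val) (m + 1)
        rw [h] at hd
        exact ⟨_, hd.symm⟩
      refine ⟨1 - (k : ℤ), ?_⟩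
      zify [b.2.le] at hk
      push_cast
      linarith
    · refine ⟨1, .inl rfl, ?_⟩
      rw [Fin.sub_def] at h
      simp only at h
      obtain ⟨k, hk⟩ : ∃ k, m + 1 - a.val + b.val = (m + 1) * k + 1 := by
        have hd := Nat.div_add_mod (m + 1 - a.val + b.val) (m + 1)
        rw [h] at hd
        exact ⟨_, hd.symm⟩
      refine ⟨(k : ℤ) - 1, ?_⟩
      zify [a.2.le] at hk
      push_cast
      linarith
  have small : ∀ x : ℤ, ((m + 1 : ℕ) : ℤ) ∣ x → |x| ≤ 5 → x = 0 := fun x hx h5 =>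
    Int.eq_zero_of_abs_lt_dvd hx (by push_cast; lia)
  constructor
  · intro a b c h1 h2 h3
    obtain ⟨x, hx, hx'⟩ := key _ _ h1
    obtain ⟨y, hy, hy'⟩ := key _ _ h2
    obtain ⟨z, hz, hz'⟩ := key _ _ h3
    have hdvd := (hx'.add hy').add hz'
    have h0 := small (-(x + y + z)) (by
      rw [show -(x + y + z) = (b.val : ℤ) - a.val - x + (c.val - b.val - y) +
        (a.val - c.val - z) by ring]
      exact hdvd) (by rw [abs_le]; lia)
    lia
  · intro a b c d e h1 h2 h3 h4 h5
    obtain ⟨x, hx, hx'⟩ := key _ _ h1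
    obtain ⟨y, hy, hy'⟩ := key _ _ h2
    obtain ⟨z, hz, hz'⟩ := key _ _ h3
    obtain ⟨u, hu, hu'⟩ := key _ _ h4
    obtain ⟨v, hv, hv'⟩ := key _ _ h5
    have hdvd := (((hx'.add hy').add hz').add hu').add hv'
    have h0 := small (-(x + y + z + u + v)) (by
      rw [show -(x + y + z + u + v) = (b.val : ℤ) - a.val - x + (c.val - b.val - y) +
        (d.val - c.val - z) + (e.val - d.val - u) + (a.val - e.val - v) by ring]
      exact hdvd) (by rw [abs_le]; lia)
    lia

/-- Deleting an edge of a cycle leaves a path, which is colored by the parity of the distance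
from one of its ends. -/
theorem cycleGraph_deleteEdges_colorable {m : ℕ} (hm : 1 ≤ m) (v w : Fin (m + 1))
    (h : (SimpleGraph.cycleGraph (m + 1)).Adj v w) :
    ((SimpleGraph.cycleGraph (m + 1)).deleteEdges {s(v, w)}).Colorable 2 := by
  obtain ⟨m, rfl⟩ : ∃ l, m = l + 1 := ⟨m - 1, by lia⟩
  wlog hvw : w - v = 1 generalizing v w
  · rw [Sym2.eq_swap]
    refine this w v h.symm ?_
    rw [SimpleGraph.cycleGraph_adj] at h
    tauto
  have step : ∀ a b : Fin (m + 1 + 1), b - a = 1 → s(a, b) ≠ s(v, w) →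
      (b - w).val = (a - w).val + 1 := by
    intro a b hab hne
    have hbw : b - w = (a - w) + 1 := by rw [← hab]; abel
    rw [hbw, Fin.val_add_one, if_neg]
    intro hlast
    apply hne
    have h1 : a - w + 1 = 0 := by rw [hlast]; simp
    have hb : b = w := sub_eq_zero.1 (hbw.trans h1)
    have ha : a = v := by
      have : w - a = w - v := by rw [hvw, ← hb, hab]
      exact sub_right_injective this
    rw [ha, hb]
  refine SimpleGraph.colorable_iff_exists_fun.2 ⟨fun a => Fin.ofNat 2 (a - w).val, ?_⟩
  intro a b hab heq
  rw [SimpleGraph.deleteEdges_adj, SimpleGraph.cycleGraph_adj] at hab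
  obtain ⟨hab, hne⟩ := hab
  have heq' : (a - w).val % 2 = (b - w).val % 2 := congrArg Fin.val heq
  rcases hab with hab | hab
  · have := step b a hab (by rw [Sym2.eq_swap]; exact hne)
    omega
  · have := step a b hab hne
    omega

theorem cycleGraph_isObstruction {n : ℕ} (hn : 7 ≤ n) (hodd : Odd n) :
    (SimpleGraph.cycleGraph n).IsObstruction 2 := by
  obtain ⟨m, rfl⟩ : ∃ l, n = l + 1 := ⟨n - 1, by lia⟩
  refine ⟨fun h => ?_, cycleGraph_deleteEdges_colorable (by lia), fun v => ?_,
    cycleGraph_noShortOdd (by lia)⟩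
  · have := h.chromaticNumber_le
    rw [SimpleGraph.chromaticNumber_cycleGraph_of_odd _ (by lia) hodd] at this
    exact absurd this (by norm_num)
  · obtain ⟨m, rfl⟩ : ∃ l, m = l + 1 := ⟨m - 1, by lia⟩
    exact ⟨v + 1, by rw [SimpleGraph.cycleGraph_adj]; right; abel⟩

theorem obstructionExists_two {n : ℕ} (hn : 7 ≤ n) (hodd : Odd n) : ObstructionExists 2 n 0 :=
  ⟨Fin n, inferInstance, _, cycleGraph_isObstruction hn hodd, by simp, Nat.zero_le _⟩

/-! ### Sizes of gadgets -/

namespace ObstructionExists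

variable {p q n e : ℕ}

theorem exists_shadow (h : ObstructionExists q n e) (hp : q + 1 = p) :
    ∃ g : Gadget p q, g.U.ncard = n ∧ Fintype.card g.X = 2 * n ∧
      3 * e ≤ g.Releasable.ncard ∧ ∀ x, ∃ e ∈ g.Releasable, x ∈ e := by
  subst hp
  obtain ⟨V, _, G, hG, rfl, he⟩ := h
  refine ⟨shadowGadget hG, ?_, ?_, ?_, ?_⟩
  · exact (Set.ncard_range_of_injective Sum.inr_injective).trans Nat.card_eq_fintype_card
  · exact Fintype.card_sum.trans (two_mul _).symm
  · rw [releasable_shadowGadget]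
    exact (Nat.mul_le_mul_left 3 he).trans three_mul_card_edgeSet_le_shadowGraph
  · rw [releasable_shadowGadget]
    exact exists_mem_shadowGraph hG

/-- Pendant vertices at the shadows make the terminals far from each other. -/
theorem exists_far_one (h : ObstructionExists q n e) (hp : q + 1 = p) :
    ∃ g : Gadget p 1, g.Far ∧ g.U.ncard = n ∧ Fintype.card g.X = 3 * n ∧
      3 * e ≤ g.Releasable.ncard ∧ ∀ x, x ∈ g.U ∨ ∃ e ∈ g.Releasable, x ∈ e := by
  subst hp
  obtain ⟨g₀, hU, hX, he, hcov⟩ := h.exists_shadow rfl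
  let g : ∀ i : Fin 1, Gadget (q + 1) (q + i) := Fin.cases g₀ fun i => i.elim0
  have hg : g 0 = g₀ := rfl
  refine ⟨.prod q 1 g, Gadget.far_prod g, ?_, ?_, ?_, ?_⟩
  · rw [Gadget.ncard_U_prod, Fin.prod_univ_one, hg]
    exact hU
  · rw [Gadget.card_X_prod, Fin.prod_univ_one, Fin.sum_univ_one,
      show Fintype.card (g 0).X = 2 * n from hX, show (g 0).U.ncard = n from hU]
    lia
  · refine he.trans (le_trans ?_ (Set.ncard_le_ncard (Gadget.releasable_prod_one g)))
    refine (Set.ncard_image_of_injective _ (Sym2.map.injective fun a b hab => ?_)).ge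
    exact eq_of_heq (Sigma.mk.inj (Sum.inl.inj hab)).2
  · rintro (⟨i, a⟩ | f)
    · obtain rfl : i = 0 := Subsingleton.elim _ _
      obtain ⟨e, he, hae⟩ := hcov a
      exact .inr ⟨_, Gadget.releasable_prod_one g ⟨e, he, rfl⟩, Sym2.mem_map.2 ⟨a, hae, rfl⟩⟩
    · exact .inl ⟨f, rfl⟩

theorem nonempty_gadget (h : ObstructionExists q n e) (hp : q + 1 = p) {s : ℕ} (hs : s ≤ q) :
    Nonempty (Gadget p s) := by
  obtain ⟨g, -⟩ := h.exists_shadow hp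
  exact g.exists_of_le hs (by lia)

end ObstructionExists

theorem Gadget.exists_far_prod_last {p r t : ℕ} (hp : r + t + 1 = p)
    (g : ∀ i : Fin t, Gadget p (r + i)) {s : ℕ} (hs : s = r + t) (g' : Gadget p s) :
    ∃ h : Gadget p (t + 1), h.Far ∧ h.U.ncard = (∏ i, (g i).U.ncard) * g'.U.ncard ∧
      Fintype.card h.X = ∑ i, Fintype.card (g i).X + Fintype.card g'.X +
        (∏ i, (g i).U.ncard) * g'.U.ncard := by
  subst hp hs
  let G : ∀ i : Fin (t + 1), Gadget (r + (t + 1)) (r + i) :=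
    Fin.lastCases (motive := fun i => Gadget (r + (t + 1)) (r + i)) g' g
  have h1 : ∀ i : Fin t, G i.castSucc = g i := fun i => Fin.lastCases_castSucc ..
  have h2 : G (Fin.last t) = g' := Fin.lastCases_last ..
  have hU : ∏ i, (G i).U.ncard = (∏ i, (g i).U.ncard) * g'.U.ncard := by
    rw [Fin.prod_univ_castSucc]
    exact congrArg₂ (· * ·) (Finset.prod_congr rfl fun i _ =>
      congrArg (fun g : Gadget (r + t + 1) (r + i) => g.U.ncard) (h1 i))
      (congrArg (fun g : Gadget (r + t + 1) (r + t) => g.U.ncard) h2)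
  have hX : ∑ i, Fintype.card (G i).X = ∑ i, Fintype.card (g i).X + Fintype.card g'.X := by
    rw [Fin.sum_univ_castSucc]
    exact congrArg₂ (· + ·) (Finset.sum_congr rfl fun i _ =>
      congrArg (fun g : Gadget (r + t + 1) (r + i) => Fintype.card g.X) (h1 i))
      (congrArg (fun g : Gadget (r + t + 1) (r + t) => Fintype.card g.X) h2)
  exact ⟨.prod r (t + 1) G, Gadget.far_prod G, (Gadget.ncard_U_prod G).trans hU,
    (Gadget.card_X_prod G).trans (by rw [hU, hX])⟩

theorem Gadget.ncard_U_pos {p s : ℕ} (g : Gadget p s) : 0 < g.U.ncard :=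
  (Set.ncard_pos (Set.toFinite _)).2 g.nonempty_U

/-- There are gadgets with many terminals that force all but one of the colors. -/
theorem exists_large_gadget {p s : ℕ} (hs : 1 ≤ s) (hp : s + 2 = p)
    (h : ∀ m, ∃ n e, m ≤ n ∧ ObstructionExists (s + 1) n e) (M : ℕ) :
    ∃ g : Gadget p s, M ≤ g.U.ncard := by
  obtain ⟨t, rfl⟩ : ∃ t, s = t + 1 := ⟨s - 1, by lia⟩
  obtain ⟨n, e, hn, he⟩ := h M
  obtain ⟨g', hg', -⟩ := he.exists_shadow (p := p) (by lia)
  have hg : ∀ i : Fin t, Nonempty (Gadget p (2 + i)) := fun i =>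
    he.nonempty_gadget (by lia) (by have := i.2; lia)
  obtain ⟨G, -, hG, -⟩ := Gadget.exists_far_prod_last (r := 2) (t := t) (p := p) (by lia)
    (fun i => (hg i).some) (by lia) g'
  refine ⟨G, hn.trans ?_⟩
  rw [hG, hg']
  exact Nat.le_mul_of_pos_left _ (Finset.prod_pos fun i _ => Gadget.ncard_U_pos _)

theorem exists_far {p r t : ℕ} (hp : r + t = p) (hp' : 0 < p) {n e : ℕ}
    (h : ObstructionExists (p - 1) n e) : ∃ g : Gadget p t, g.Far := by
  have hg : ∀ i : Fin t, Nonempty (Gadget p (r + i)) := fun i =>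
    h.nonempty_gadget (by lia) (by have := i.2; lia)
  subst hp
  exact ⟨.prod r t fun i => (hg i).some, Gadget.far_prod _⟩

/-- Products of a gadget of varying order with fixed gadgets: with `n` varying, almost all
vertices are terminals. -/
theorem exists_far_dense {p r t : ℕ} (ht : 1 ≤ t) (hr : 2 ≤ r + t) (hp : r + t + 1 = p)
    (h : ∀ m, ∃ n e, m ≤ n ∧ ObstructionExists (r + t) n e) (M : ℕ) :
    ∃ D C, M ≤ D ∧ ∀ n e, ObstructionExists (r + t) n e →
      ∃ g : Gadget p (t + 1), g.Far ∧ g.U.ncard = D * n ∧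
        Fintype.card g.X = D * n + 2 * n + C := by
  obtain ⟨n₀, e₀, -, h₀⟩ := h 0
  have hg : ∀ i : Fin t, ∃ g : Gadget p (r + i), i.val + 1 = t → M ≤ g.U.ncard := by
    intro i
    by_cases hi : i.val + 1 = t
    · obtain ⟨g, hg⟩ := exists_large_gadget (p := p) (s := r + i) (by lia) (by lia)
        (by rw [show r + i + 1 = r + t by lia]; exact h) M
      exact ⟨g, fun _ => hg⟩
    · exact ⟨(h₀.nonempty_gadget hp (by have := i.2; lia)).some, fun h => absurd h hi⟩
  choose g hgM using hg
  refine ⟨∏ i, (g i).U.ncard, ∑ i, Fintype.card (g i).X, ?_, fun n e hn => ?_⟩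
  · exact (hgM ⟨t - 1, by lia⟩ (by simp; lia)).trans (Nat.le_of_dvd
      (Finset.prod_pos fun i _ => (g i).ncard_U_pos) (Finset.dvd_prod_of_mem _ (Finset.mem_univ _)))
  · obtain ⟨g', hU, hX, -⟩ := hn.exists_shadow hp
    obtain ⟨G, hG, hGU, hGX⟩ := Gadget.exists_far_prod_last hp g rfl g'
    refine ⟨G, hG, by rw [hGU, hU], ?_⟩
    rw [hGX, hU, hX]
    ring

/-! ### Orders of obstructions -/

/-- The orders of the obstructions to `q`-colorability have bounded gaps: an obstruction of order
`n` extends to one of order about `3 * n` with one more color, the rest of it being fixed. -/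
theorem exists_obstruction_order {q : ℕ} (hq : 2 ≤ q) :
    ∃ C, ∀ m, ∃ n e, m ≤ n ∧ n ≤ m + C ∧ ObstructionExists q n e := by
  induction q, hq using Nat.le_induction with
  | base =>
    refine ⟨8, fun m => ?_⟩
    rcases Nat.even_or_odd m with hm | hm
    · exact ⟨m + 7, 0, by lia, by lia, obstructionExists_two (by lia) (by
        rw [Nat.odd_iff]; rw [Nat.even_iff] at hm; omega)⟩
    · exact ⟨m + 8, 0, by lia, by lia, obstructionExists_two (by lia) (by
        rw [Nat.odd_iff] at *; omega)⟩
  | succ q hq ih =>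
    obtain ⟨C, hC⟩ := ih
    obtain ⟨n₀, e₀, -, -, h₀⟩ := hC 0
    obtain ⟨g₂, hg₂⟩ := exists_far (r := 2) (t := q - 1) (p := q + 1) (by lia) (by lia) h₀
    refine ⟨3 + 3 * C + Fintype.card g₂.X, fun m => ?_⟩
    obtain ⟨n, e, hn, hn', h⟩ := hC (m / 3 + 1)
    obtain ⟨g₁, hg₁, -, hX, -, hcov⟩ := h.exists_far_one rfl
    obtain ⟨N, hN, hN', hobs⟩ := Gadget.exists_obstruction (by lia) g₁ g₂ hg₁ hg₂
    have := hN' hcov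
    exact ⟨N, _, by lia, by lia, hobs⟩

/-! ### From obstructions to critical graphs and densities -/

theorem SimpleGraph.IsObstruction.isColorCritical {V : Type*} {q : ℕ} {G : SimpleGraph V}
    (hG : G.IsObstruction q) : G.IsColorCritical (q + 1) := by
  constructor
  · have hne : Nonempty V := by
      by_contra h
      rw [not_nonempty_iff] at h
      exact hG.not_colorable (.of_isEmpty q)
    obtain ⟨c, -, -, hc⟩ := hG.exists_fun_special (P := Finset.univ.erase (0 : Fin (q + 1)))
      (by simp) (x := 0) (by simp) hne.some
    exact_mod_cast chromaticNumber_eq_iff_colorable_not_colorable.2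
      ⟨colorable_iff_exists_fun.2 ⟨c, hc⟩, hG.not_colorable⟩
  · intro e he
    induction e with | _ v w
    exact hG.colorable_deleteEdges v w he

theorem SimpleGraph.four_mul_ncard_edgeSet_le {V : Type*} [Fintype V] {G : SimpleGraph V}
    (hG : G.CliqueFree 3) : 4 * G.edgeSet.ncard ≤ Fintype.card V ^ 2 := by
  classical
  have h := CliqueFree.card_edgeFinset_le (r := 2) hG
  rw [← coe_edgeFinset, Set.ncard_coe_finset]
  dsimp only at h
  have h0 := Nat.mod_two_eq_zero_or_one (Fintype.card V)
  rcases h0 with h0 | h0 <;> rw [h0] at h <;> norm_num at h <;> omega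

namespace ObstructionExists

variable {q n e : ℕ}

theorem exists_fin (h : ObstructionExists q n e) :
    ∃ G : SimpleGraph (Fin n), G.IsObstruction q ∧ e ≤ G.edgeSet.ncard := by
  obtain ⟨V, _, G, hG, rfl, he⟩ := h
  let φ : G.overFin rfl ≃g G := (G.overFinIso rfl).symm
  refine ⟨G.overFin rfl, ⟨fun h => hG.not_colorable (h.of_hom φ.symm.toHom), fun v w hvw => ?_,
    fun v => ?_, hG.noShortOdd.comap φ fun a b => φ.map_rel_iff.2⟩, ?_⟩
  · refine (hG.colorable_deleteEdges (φ v) (φ w) (φ.map_rel_iff.2 hvw)).of_hom ⟨φ, ?_⟩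
    intro a b hab
    rw [SimpleGraph.deleteEdges_adj] at hab ⊢
    refine ⟨φ.map_rel_iff.2 hab.1, fun h => hab.2 ?_⟩
    simpa [Sym2.eq_iff] using h
  · obtain ⟨w, hw⟩ := hG.exists_adj (φ v)
    exact ⟨φ.symm w, φ.map_rel_iff.1 (by simpa using hw)⟩
  · rw [← Nat.card_coe_set_eq] at he ⊢
    rwa [Nat.card_congr φ.mapEdgeSet]

theorem four_mul_le (h : ObstructionExists q n e) : 4 * e ≤ n ^ 2 := by
  obtain ⟨V, _, G, hG, rfl, he⟩ := h
  have := SimpleGraph.four_mul_ncard_edgeSet_le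
    (SimpleGraph.cliqueFree_three_of_lt_oddGirth hG.noShortOdd.lt_oddGirth)
  lia

end ObstructionExists

theorem mem_densitySet {q : ℕ} {c : ℝ}
    (h : ∀ m, ∃ n e, m ≤ n ∧ ObstructionExists q n e ∧ c * (n : ℝ) ^ 2 < e) :
    c ∈ densitySet 5 (q + 1) := by
  refine ⟨{G | G.2.IsColorCritical (q + 1) ∧ ((5 : ℕ) : ℕ∞) < G.2.oddGirth ∧
    c * (G.order : ℝ) ^ 2 < (G.size : ℝ)}, ?_, fun G hG => hG⟩
  refine Set.Infinite.of_image FinGraph.order (Set.infinite_of_forall_exists_gt fun m => ?_)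
  obtain ⟨n, e, hn, hobs, hlt⟩ := h (m + 1)
  obtain ⟨G, hG, he⟩ := hobs.exists_fin
  refine ⟨n, ⟨⟨n, G⟩, ⟨hG.isColorCritical, hG.noShortOdd.lt_oddGirth, hlt.trans_le ?_⟩, rfl⟩, hn⟩
  exact_mod_cast he

/-- Mantel's bound; a graph without vertices cannot satisfy the strict inequality. -/
theorem lt_of_mem_densitySet {k : ℕ} {c : ℝ} (hc : c ∈ densitySet 5 k) : c < 1 / 4 := by
  obtain ⟨F, hF, h⟩ := hc
  obtain ⟨⟨n, G⟩, hG⟩ := hF.nonempty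
  obtain ⟨-, hgirth, hlt⟩ := h _ hG
  have h4 := SimpleGraph.four_mul_ncard_edgeSet_le
    (SimpleGraph.cliqueFree_three_of_lt_oddGirth hgirth)
  rw [Fintype.card_fin] at h4
  have h4' : 4 * (G.edgeSet.ncard : ℝ) ≤ (n : ℝ) ^ 2 := by exact_mod_cast h4
  have hlt' : c * (n : ℝ) ^ 2 < (G.edgeSet.ncard : ℝ) := hlt
  by_contra! hc
  nlinarith [sq_nonneg (n : ℝ)]

theorem le_densityConstant {k : ℕ} {L : ℝ} (hL : 0 < L)
    (h : ∀ c, 0 < c → c < L → c ∈ densitySet 5 k) : L ≤ densityConstant 5 k := by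
  have hbdd : BddAbove (densitySet 5 k) := ⟨1 / 4, fun c hc => (lt_of_mem_densitySet hc).le⟩
  refine le_of_forall_lt_imp_le_of_dense fun c hc => ?_
  refine (le_max_left c (L / 2)).trans (le_csSup hbdd (h _ ?_ ?_))
  · exact lt_max_of_lt_right (by linarith)
  · exact max_lt hc (by linarith)

/-- Lower order terms are negligible. -/
theorem exists_forall_mul_sq_lt {a b c g : ℝ} (hc : 0 < c) (h : c * a ^ 2 < g) :
    ∃ M₀ : ℕ, 0 < M₀ ∧ ∀ M : ℕ, M₀ ≤ M → c * (a * M + b) ^ 2 < g * (M : ℝ) ^ 2 := by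
  obtain ⟨M₀, hM₀⟩ := exists_nat_gt ((2 * a * b * c + c * b ^ 2) / (g - c * a ^ 2))
  refine ⟨M₀ + 1, by lia, fun M hM => ?_⟩
  have hM1 : (M₀ : ℝ) + 1 ≤ M := by exact_mod_cast hM
  have hM0 : (0 : ℝ) ≤ M₀ := Nat.cast_nonneg _
  have hpos : 0 < g - c * a ^ 2 := by linarith
  rw [div_lt_iff₀ hpos] at hM₀
  have h1 : 2 * a * b * c + c * b ^ 2 < M * (g - c * a ^ 2) := by nlinarith
  have h2 : 0 ≤ c * b ^ 2 := by positivity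
  nlinarith [mul_lt_mul_of_pos_right h1 (show (0 : ℝ) < M by linarith),
    mul_le_mul_of_nonneg_left (show (1 : ℝ) ≤ M by linarith) h2]

theorem exists_forall_mul_add_div_sq_lt {a b c g : ℝ} (hc : 0 < c) (h : c * a ^ 2 < g) :
    ∃ M₀ : ℕ, 0 < M₀ ∧ ∀ M : ℕ, M₀ ≤ M → c * (a + b / M) ^ 2 < g := by
  obtain ⟨M₀, h₀, hM₀⟩ := exists_forall_mul_sq_lt hc h
  refine ⟨M₀, h₀, fun M hM => ?_⟩
  have hM' : (0 : ℝ) < M := by exact_mod_cast h₀.trans_le hM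
  have h1 := hM₀ M hM
  rw [show a * (M : ℝ) + b = (a + b / M) * M by field_simp, mul_pow, ← mul_assoc] at h1
  exact lt_of_mul_lt_mul_right h1 (by positivity)

/-- Multiples of orders of obstructions come close to any given number. -/
theorem exists_obstruction_mul_order {q : ℕ} (hq : 2 ≤ q) {D : ℕ} (hD : 0 < D) :
    ∃ C, ∀ M, ∃ n e, ObstructionExists q n e ∧ M ≤ D * n ∧ D * n ≤ M + C := by
  obtain ⟨C, hC⟩ := exists_obstruction_order hq
  refine ⟨D * (1 + C), fun M => ?_⟩
  obtain ⟨n, e, hn, hn', h⟩ := hC (M / D + 1)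
  refine ⟨n, e, h, ?_, ?_⟩
  · exact (Nat.lt_mul_div_succ M hD).le.trans (Nat.mul_le_mul_left D hn)
  · calc D * n ≤ D * (M / D + 1 + C) := Nat.mul_le_mul_left D hn'
      _ = D * (M / D) + D * (1 + C) := by ring
      _ ≤ M + D * (1 + C) := Nat.add_le_add_right (Nat.mul_div_le M D) _

/-! ### The densities -/

/-- Two odd cycles of length `N`, with shadows and pendant vertices at the shadows. -/
theorem exists_obstruction_three (m : ℕ) :
    ∃ n e, m ≤ n ∧ 0 < n ∧ n ^ 2 ≤ 36 * e ∧ ObstructionExists 3 n e := by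
  have h := obstructionExists_two (n := 2 * m + 7) (by lia) ⟨m + 3, by ring⟩
  obtain ⟨g, hg, hU, hX, -, hcov⟩ := h.exists_far_one rfl
  obtain ⟨n, hn, hn', hobs⟩ := Gadget.exists_obstruction (p := 3) (by lia) g g hg hg
  have := hn' hcov
  refine ⟨n, _, by lia, by lia, ?_, hobs⟩
  have h1 : n ≤ 6 * (2 * m + 7) := by lia
  calc n ^ 2 ≤ (6 * (2 * m + 7)) ^ 2 := Nat.pow_le_pow_left h1 2
    _ = 36 * ((2 * m + 7) * (2 * m + 7)) := by ring
    _ ≤ _ := by rw [hU]; lia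

theorem mem_densitySet_four {c : ℝ} (hc : c < 1 / 36) : c ∈ densitySet 5 4 := by
  refine mem_densitySet (q := 3) fun m => ?_
  obtain ⟨n, e, hn, hpos, he, hobs⟩ := exists_obstruction_three m
  refine ⟨n, e, hn, hobs, ?_⟩
  have he' : (n : ℝ) ^ 2 ≤ 36 * e := by exact_mod_cast he
  have hpos' : (0 : ℝ) < (n : ℝ) ^ 2 := by positivity
  nlinarith

/-- A dense `4`-chromatic obstruction of order `N` with its shadows and pendant vertices on one
side, and about `17 * N / 6` terminals on the other side, almost without overhead. -/
theorem mem_densitySet_five {c : ℝ} (hc0 : 0 < c) (hc : c < 3 / 35) : c ∈ densitySet 5 5 := by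
  refine mem_densitySet (q := 4) fun m => ?_
  obtain ⟨D₀, hD₀, hD⟩ := exists_forall_mul_add_div_sq_lt (a := 35 / 6) (b := 17 / 3)
    (g := 35 / 12) hc0 (by linarith)
  obtain ⟨C₀, hC₀⟩ := exists_obstruction_order (q := 3) (by norm_num)
  obtain ⟨D, C₁, hDD, hdense⟩ := exists_far_dense (p := 4) (r := 2) (t := 1) (by lia) (by lia)
    rfl (fun m => by
      obtain ⟨n, e, h1, -, h2⟩ := hC₀ m
      exact ⟨n, e, h1, h2⟩) D₀
  have hDpos : 0 < D := hD₀.trans_le hDD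
  obtain ⟨C₂, hC₂⟩ := exists_obstruction_mul_order (q := 3) (by norm_num) hDpos
  have hD' := hD D hDD
  obtain ⟨M₀, -, hM₀⟩ := exists_forall_mul_sq_lt (a := 35 / 6 + 17 / 3 / D)
    (b := 3 * (1 + C₂) + C₁) (g := 35 / 12) hc0 hD'
  obtain ⟨N, e, hN, -, he, hA⟩ := exists_obstruction_three (max m M₀)
  obtain ⟨N₂, e₂, hB, hl, hu⟩ := hC₂ ((17 * N + 5) / 6)
  obtain ⟨g₁, hg₁, hU₁, hX₁, hR₁, hcov⟩ := hA.exists_far_one rfl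
  obtain ⟨g₂, hg₂, hU₂, hX₂⟩ := hdense N₂ e₂ hB
  obtain ⟨n, hn, hn', hobs⟩ := Gadget.exists_obstruction (by lia) g₁ g₂ hg₁ hg₂
  have hlow := hn' hcov
  refine ⟨n, _, by lia, hobs, ?_⟩
  have hDr : (0 : ℝ) < D := by exact_mod_cast hDpos
  have hD1 : (1 : ℝ) ≤ D := by exact_mod_cast hDpos
  -- the order
  have hDN : (D : ℝ) * N₂ ≤ 17 / 6 * N + 1 + C₂ := by
    have : 6 * (D * N₂) ≤ 17 * N + 5 + 6 * C₂ := by lia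
    have : 6 * ((D : ℝ) * N₂) ≤ 17 * N + 5 + 6 * C₂ := by exact_mod_cast this
    linarith
  have hN₂ : (N₂ : ℝ) ≤ 17 / 6 / D * N + (1 + C₂) := by
    have h0 : (0 : ℝ) ≤ 1 + C₂ := by positivity
    refine le_of_mul_le_mul_left ?_ hDr
    calc (D : ℝ) * N₂ ≤ 17 / 6 * N + (1 + C₂) := by linarith
      _ ≤ 17 / 6 * N + D * (1 + C₂) := by nlinarith
      _ = D * (17 / 6 / D * N + (1 + C₂)) := by field_simp
  have hnr : (n : ℝ) ≤ (35 / 6 + 17 / 3 / D) * N + (3 * (1 + C₂) + C₁) := by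
    have : n ≤ 3 * N + (D * N₂ + 2 * N₂ + C₁) := by lia
    have : (n : ℝ) ≤ 3 * N + (D * N₂ + 2 * N₂ + C₁) := by exact_mod_cast this
    calc (n : ℝ) ≤ 3 * N + ((17 / 6 * N + 1 + C₂) + 2 * (17 / 6 / D * N + (1 + C₂)) + C₁) := by
          linarith
      _ = _ := by ring
  -- the size
  have hsize : 35 / 12 * (N : ℝ) ^ 2 ≤
      ((g₁.U.ncard * g₂.U.ncard + g₁.Releasable.ncard : ℕ) : ℝ) := by
    have h1 : 17 * N ≤ 6 * (D * N₂) := by lia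
    have h2 : 35 * N ^ 2 ≤ 12 * (N * (D * N₂) + 3 * e) := by nlinarith
    have h3 : 35 * N ^ 2 ≤ 12 * (g₁.U.ncard * g₂.U.ncard + g₁.Releasable.ncard) := by
      rw [hU₁, hU₂]
      lia
    have h4 : 35 * (N : ℝ) ^ 2 ≤
        12 * ((g₁.U.ncard * g₂.U.ncard + g₁.Releasable.ncard : ℕ) : ℝ) := by exact_mod_cast h3
    linarith
  refine lt_of_lt_of_le (lt_of_le_of_lt ?_ (hM₀ N (by lia))) hsize
  gcongr

/-- Two products of gadgets with about `M` terminals each, almost without overhead. -/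
theorem mem_densitySet_of_six_le {k : ℕ} (hk : 6 ≤ k) {c : ℝ} (hc0 : 0 < c) (hc : c < 1 / 4) :
    c ∈ densitySet 5 k := by
  obtain ⟨q, rfl⟩ : ∃ q, k = q + 3 + 1 + 1 := ⟨k - 5, by lia⟩
  refine mem_densitySet fun m => ?_
  obtain ⟨D₀, hD₀, hD⟩ := exists_forall_mul_add_div_sq_lt (a := 2) (b := 4)
    (g := 1) hc0 (by linarith)
  obtain ⟨C₀, hC₀⟩ := exists_obstruction_order (q := q + 3) (by lia)
  have hex : ∀ m, ∃ n e, m ≤ n ∧ ObstructionExists (q + 3) n e := fun m => by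
    obtain ⟨n, e, h1, -, h2⟩ := hC₀ m
    exact ⟨n, e, h1, h2⟩
  obtain ⟨D₁, C₁, hD₁, hdense₁⟩ := exists_far_dense (p := q + 3 + 1) (r := q + 2) (t := 1)
    (by lia) (by lia) rfl hex D₀
  obtain ⟨D₂, C₂, hD₂, hdense₂⟩ := exists_far_dense (p := q + 3 + 1) (r := 3) (t := q)
    (by lia) (by lia) (by lia) (by rwa [add_comm] at hex) D₀
  obtain ⟨B₁, hB₁⟩ := exists_obstruction_mul_order (q := q + 3) (by lia) (hD₀.trans_le hD₁)
  obtain ⟨B₂, hB₂⟩ := exists_obstruction_mul_order (q := q + 3) (by lia) (hD₀.trans_le hD₂)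
  have hD' := hD D₀ le_rfl
  obtain ⟨M₀, -, hM₀⟩ := exists_forall_mul_sq_lt (a := 2 + 4 / D₀)
    (b := 3 * B₁ + 3 * B₂ + C₁ + C₂) (g := 1) hc0 hD'
  let M := max m M₀
  obtain ⟨N₁, e₁, hA, hl₁, hu₁⟩ := hB₁ M
  obtain ⟨N₂, e₂, hB, hl₂, hu₂⟩ := hB₂ M
  obtain ⟨g₁, hg₁, hU₁, hX₁⟩ := hdense₁ N₁ e₁ hA
  obtain ⟨g₂, hg₂, hU₂, hX₂⟩ := hdense₂ N₂ e₂ (by rwa [add_comm])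
  obtain ⟨n, hn, -, hobs⟩ := Gadget.exists_obstruction (by lia) g₁ g₂ hg₁ hg₂
  have hsize : M ^ 2 ≤ g₁.U.ncard * g₂.U.ncard + g₁.Releasable.ncard := by
    rw [hU₁, hU₂, sq]
    exact (Nat.mul_le_mul hl₁ hl₂).trans (Nat.le_add_right _ _)
  have hMn : M ≤ n := by
    have := hobs.four_mul_le
    exact (Nat.pow_le_pow_iff_left two_ne_zero).1 (by lia)
  refine ⟨n, _, (le_max_left m M₀).trans hMn, hobs, ?_⟩
  have hDr : (0 : ℝ) < D₀ := by exact_mod_cast hD₀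
  have hD1 : (1 : ℝ) ≤ D₀ := by exact_mod_cast hD₀
  have bound : ∀ D N B : ℕ, D₀ ≤ D → D * N ≤ M + B → (N : ℝ) ≤ 1 / D₀ * M + B := by
    intro D N B hle hu
    have h1 : D₀ * N ≤ M + B := (Nat.mul_le_mul_right N hle).trans hu
    have h2 : (D₀ : ℝ) * N ≤ M + B := by exact_mod_cast h1
    have h0 : (0 : ℝ) ≤ B := Nat.cast_nonneg _
    refine le_of_mul_le_mul_left ?_ hDr
    calc (D₀ : ℝ) * N ≤ M + B := h2
      _ ≤ M + D₀ * B := by nlinarith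
      _ = D₀ * (1 / D₀ * M + B) := by field_simp
  have hN₁ := bound D₁ N₁ B₁ hD₁ hu₁
  have hN₂ := bound D₂ N₂ B₂ hD₂ hu₂
  have hnr : (n : ℝ) ≤ (2 + 4 / D₀) * M + (3 * B₁ + 3 * B₂ + C₁ + C₂) := by
    have : n ≤ 2 * M + (B₁ + B₂) + 2 * N₁ + 2 * N₂ + C₁ + C₂ := by lia
    have : (n : ℝ) ≤ 2 * M + (B₁ + B₂) + 2 * N₁ + 2 * N₂ + C₁ + C₂ := by exact_mod_cast this
    calc (n : ℝ) ≤ 2 * M + (B₁ + B₂) + 2 * (1 / D₀ * M + B₁) + 2 * (1 / D₀ * M + B₂) + C₁ + C₂ := by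
          linarith
      _ = _ := by ring
  have hsize' : 1 * (M : ℝ) ^ 2 ≤
      ((g₁.U.ncard * g₂.U.ncard + g₁.Releasable.ncard : ℕ) : ℝ) := by
    rw [one_mul]
    exact_mod_cast hsize
  refine lt_of_lt_of_le (lt_of_le_of_lt ?_ (hM₀ M (le_max_right m M₀))) hsize'
  gcongr

theorem theorem2 :
    (∃ F : Set FinGraph,
      (∃ c : ℝ, 0 < c ∧ ∀ G ∈ F, c * (G.order : ℝ) ^ 2 < (G.size : ℝ)) ∧
      (∀ G ∈ F, (∃ k : ℕ, G.2.IsColorCritical k) ∧ (5 : ℕ∞) < G.2.oddGirth) ∧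
      (∀ k : ℕ, 4 ≤ k → {G ∈ F | G.2.chromaticNumber = (k : ℕ∞)}.Infinite)) ∧
    1 / 36 ≤ densityConstant 5 4 ∧
    3 / 35 ≤ densityConstant 5 5 ∧
    ∀ k : ℕ, 6 ≤ k → densityConstant 5 k = 1 / 4 := by
  refine ⟨⟨{G | (∃ k : ℕ, G.2.IsColorCritical k) ∧ (5 : ℕ∞) < G.2.oddGirth ∧
      1 / 40 * (G.order : ℝ) ^ 2 < (G.size : ℝ)}, ⟨1 / 40, by norm_num, fun G hG => hG.2.2⟩,
      fun G hG => ⟨hG.1, hG.2.1⟩, fun k hk => ?_⟩,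
    le_densityConstant (by norm_num) fun c _ hc => mem_densitySet_four hc,
    le_densityConstant (by norm_num) fun c hc0 hc => mem_densitySet_five hc0 hc,
    fun k hk => le_antisymm ?_ <|
      le_densityConstant (by norm_num) fun c hc0 hc => mem_densitySet_of_six_le hk hc0 hc⟩
  · have hmem : (1 / 40 : ℝ) ∈ densitySet 5 k := by
      obtain rfl | rfl | hk : k = 4 ∨ k = 5 ∨ 6 ≤ k := by lia
      · exact mem_densitySet_four (by norm_num)
      · exact mem_densitySet_five (by norm_num) (by norm_num)
      · exact mem_densitySet_of_six_le hk (by norm_num) (by norm_num)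
    obtain ⟨F, hF, h⟩ := hmem
    exact hF.mono fun G hG => ⟨⟨⟨k, (h G hG).1⟩, (h G hG).2⟩, (h G hG).1.1⟩
  · exact Real.sSup_le (fun c hc => (lt_of_mem_densitySet hc).le) (by norm_num)
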